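/- Let $K\in\mathbb N$, $\varepsilon\in(0,1)$ and, for a power $P>1$, $\mu=P^{-\varepsilon}$. The Wyner channel $\mathbf H\in\mathbb C^{K\times K}$ is tridiagonal with $H_{i,i}=d_i$, $H_{i,i+1}=\mu a_i$, $H_{i,i-1}=\mu b_i$, where all $a_i,b_i,d_i$ are i.i.d. $\mathcal{CN}(0,1)$. *Distributed CSI by random vector quantization (RVQ).* Let $g_i=(b_i,d_i,a_i)$ be the vector of fading coefficients of row $i$ (without $b_1$ for $i=1$ and without $a_K$ for $i=K$). For all $i,j$, a codebook of $2^{\beta_{ij}}$ independent codewords, uniform on the unit sphere of the space of $g_i$, is drawn; all codebooks are independent of each other and of the channel. TX $j$ obtains the codeword $w$ of its codebook that maximizes $|w^{\mathsf H}g_i|$, multiplied by the unit-modulus scalar that makes the entry corresponding to $d_i$ real and nonnegative. With these estimates in place of $g_1,\dots,g_K$ (and with the known factor $\mu$) it forms the tridiagonal estimate $\mathbf H^{(j)}$ of $\mathbf H$. *Distributed zero forcing.* TX $j$ computes $\mathbf t^{(j)}_i=\sqrt P\,(\mathbf H^{(j)})^{-1}\mathbf e_i/\|(\mathbf H^{(j)})^{-1}\mathbf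 e_i\|$ for all $i$, and the effective precoder $\mathbf T=[\mathbf t_1,\dots,\mathbf t_K]$ has the entries $T_{ji}=(\mathbf t^{(j)}_i)_j$. With $\mathbf h_i^{\mathsf H}$ the $i$-th row of $\mathbf H$, the average rate of user $i$ is $$R_i=\mathbb E\left[\log_2\left(1+\frac{|\mathbf h_i^{\mathsf H}\mathbf t_i|^2}{1+\sum_{\ell\ne i}|\mathbf h_i^{\mathsf H}\mathbf t_\ell|^2}\right)\right],$$ the expectation being over the channel and the codebooks, and the multiplexing gain at RX $i$ is $\lim_{P\to\infty}R_i/\log_2 P$. **Theorem.** Suppose that the numbers of bits $\beta_{ij}=\beta_{ij}(P)$ are obtained by rounding (up or down) the decaying allocation $$B_i^{(j)}=\max\left(2\log_2\left(P\mu^{2|i-j|}\right),0\right).$$ Then the maximal multiplexing gain is achieved at every RX: for every $i$, $\lim_{P\to\infty}R_i/\log_2P=1$. Here $1$ is maximal: the effective precoders are measurable with $\|\mathbf t_\ell\|^2\le CP$ for all $\ell$, with a constant $C$ independent of $P$, and for every family of precoders with these two properties, even if they depend arbitrarily on the whole channel and on independent randomness, $\limsup_{P\to\infty}R_i/\log_2P\le1$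 for every $i$. -/

import Mathlib

open MeasureTheory ProbabilityTheory Filter Topology

noncomputable section

namespace Wyner

/-- The law `CN(0,1)` on `ℂ`: independent real and imaginary parts, each `N(0,1/2)`. -/
def stdComplexGaussian : Measure ℂ :=
  ((gaussianReal 0 (1 / 2)).prod (gaussianReal 0 (1 / 2))).map
    (fun p : ℝ × ℝ => (⟨p.1, p.2⟩ : ℂ))

/-- The distance `|i - j|` of two indices. -/
def idxDist {K : ℕ} (i j : Fin K) : ℕ := ((i : ℤ) - (j : ℤ)).natAbs

/-- Deterministic attenuation: `1` on the diagonal, `μ` next to it, `0` elsewhere. -/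
def profile {K : ℕ} (μ : ℝ) (i k : Fin K) : ℂ :=
  if idxDist i k = 0 then 1 else if idxDist i k = 1 then (μ : ℂ) else 0

/-- The fading coefficients, i.i.d. `CN(0,1)`: `d_i = G i i`, `a_i = G i (i+1)`,
`b_i = G i (i-1)`; the other entries of `G` are never used. -/
def fadingLaw (K : ℕ) : Measure (Fin K → Fin K → ℂ) :=
  Measure.pi fun _ => Measure.pi fun _ => stdComplexGaussian

/-- The tridiagonal matrix with fading coefficients `G` and attenuation factor `μ`. -/
def wynerMatrix {K : ℕ} (μ : ℝ) (G : Fin K → Fin K → ℂ) : Matrix (Fin K) (Fin K) ℂ :=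
  Matrix.of fun i k => profile μ i k * G i k

/-- Restriction of a vector to the (at most three) positions of the nonzero entries of row `i`. -/
def mask {K : ℕ} (i : Fin K) (v : Fin K → ℂ) : Fin K → ℂ :=
  fun k => if idxDist i k ≤ 1 then v k else 0

/-- Euclidean norm of a complex vector. -/
def l2norm {K : ℕ} (v : Fin K → ℂ) : ℝ := √(∑ k, ‖v k‖ ^ 2)

/-- Uniform law on the unit sphere of the coordinate subspace of the nonzero entries of row `i`,
as the law of the direction of a standard complex Gaussian vector of that subspace. -/
def codewordLaw {K : ℕ} (i : Fin K) : Measure (Fin K → ℂ) :=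
  (Measure.pi fun _ : Fin K => stdComplexGaussian).map
    (fun v k => mask i v k / (l2norm (mask i v) : ℂ))

/-- All the codebooks: `c i j` is the codebook of `2 ^ b i j` codewords with which the `i`-th
channel vector is quantized for TX `j`. -/
abbrev Codebooks {K : ℕ} (b : Fin K → Fin K → ℕ) : Type :=
  (i j : Fin K) → Fin (2 ^ b i j) → Fin K → ℂ

/-- All codewords of all codebooks are independent and uniform on the respective sphere. -/
def codebookLaw {K : ℕ} (b : Fin K → Fin K → ℕ) : Measure (Codebooks b) :=
  Measure.pi fun i => Measure.pi fun _ => Measure.pi fun _ => codewordLaw i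

/-- Indices at which `s` is maximal. -/
def maximizers {N : ℕ} (s : Fin N → ℝ) : Finset (Fin N) :=
  open Classical in Finset.univ.filter fun n => ∀ m, s m ≤ s n

theorem maximizers_nonempty {N : ℕ} [NeZero N] (s : Fin N → ℝ) : (maximizers s).Nonempty := by
  obtain ⟨n, hn⟩ := Finite.exists_max s
  exact ⟨n, by simpa [maximizers] using hn⟩

/-- The codeword of the codebook `W` that RVQ selects for the vector `g`: the one with the largest
`|wᴴ g|` (the first one in case of ties). -/
def rvqSelect {K N : ℕ} [NeZero N] (W : Fin N → Fin K → ℂ) (g : Fin K → ℂ) : Fin K → ℂ :=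
  W ((maximizers fun n => ‖∑ k, star (W n k) * g k‖).min' (maximizers_nonempty _))

/-- A codeword represents a direction, up to a phase. The representative used by all TXs for row
`i` is the one whose `i`-th entry (the direct channel) is real and nonnegative. -/
def fixPhase {K : ℕ} (i : Fin K) (w : Fin K → ℂ) : Fin K → ℂ :=
  fun k => Complex.exp (-(Complex.arg (w i)) * Complex.I) * w k

/-- The estimate at TX `j` of the fading coefficients: row `i` is obtained by RVQ of
the vector `(b_i, d_i, a_i)` with the codebook `c i j`. -/
def fadingEstimate {K : ℕ} {b : Fin K → Fin K → ℕ} (G : Fin K → Fin K → ℂ) (c : Codebooks b)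
    (j : Fin K) : Fin K → Fin K → ℂ :=
  fun i => fixPhase i (rvqSelect (c i j) (mask i (G i)))

/-- Zero forcing beamforming vectors, in columns: column `i` is `√P A⁻¹ e_i / ‖A⁻¹ e_i‖`. -/
def zfPrecoder {K : ℕ} (P : ℝ) (A : Matrix (Fin K) (Fin K) ℂ) : Matrix (Fin K) (Fin K) ℂ :=
  Matrix.of fun j i => (√P : ℂ) * (A⁻¹ j i / (l2norm (fun k => A⁻¹ k i) : ℂ))

/-- The effective precoder with distributed CSI: row `j` is the `j`-th row of the zero forcing
precoder that TX `j` computes from its own channel estimate. -/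
def dcsiPrecoder {K : ℕ} (μ P : ℝ) {b : Fin K → Fin K → ℕ} (G : Fin K → Fin K → ℂ)
    (c : Codebooks b) : Matrix (Fin K) (Fin K) ℂ :=
  Matrix.of fun j i => zfPrecoder P (wynerMatrix μ (fadingEstimate G c j)) j i

/-- Signal to interference and noise ratio at RX `i` for the channel `H` and the precoder `T`;
`(H * T) i l` is the product of the channel to RX `i` with the `l`-th beamforming vector. -/
def sinr {K : ℕ} (H T : Matrix (Fin K) (Fin K) ℂ) (i : Fin K) : ℝ :=
  ‖(H * T) i i‖ ^ 2 / (1 + ∑ l ∈ Finset.univ.erase i, ‖(H * T) i l‖ ^ 2)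

/-- Average rate of user `i` when the precoder is a function of the fading coefficients and of an
independent random variable of law `ν` (for instance the random codebooks). -/
def rate {K : ℕ} {Ω : Type} [MeasurableSpace Ω] (μ : ℝ) (ν : Measure Ω)
    (T : (Fin K → Fin K → ℂ) → Ω → Matrix (Fin K) (Fin K) ℂ) (i : Fin K) : ℝ :=
  ∫ x, Real.logb 2 (1 + sinr (wynerMatrix μ x.1) (T x.1 x.2) i) ∂((fadingLaw K).prod ν)

/-- A family, indexed by the power `P`, of measurable precoders whose beamforming vectors have
squared norm at most a constant times `P`. -/
def IsPrecodingFamily {K : ℕ} {Ω : ℝ → Type} [∀ P, MeasurableSpace (Ω P)]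
    (T : (P : ℝ) → (Fin K → Fin K → ℂ) → Ω P → Matrix (Fin K) (Fin K) ℂ) : Prop :=
  ∃ C : ℝ, ∀ P, 1 < P →
    (∀ j i, Measurable fun x : (Fin K → Fin K → ℂ) × Ω P => T P x.1 x.2 j i) ∧
    ∀ G ω i, l2norm (fun j => T P G ω j i) ^ 2 ≤ C * P

/-- The multiplexing gain at RX `i`, with `μ = P ^ (-ε)`, exists and equals `g`. -/
def HasMultiplexingGain {K : ℕ} {Ω : ℝ → Type} [∀ P, MeasurableSpace (Ω P)] (ε : ℝ)
    (ν : (P : ℝ) → Measure (Ω P))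
    (T : (P : ℝ) → (Fin K → Fin K → ℂ) → Ω P → Matrix (Fin K) (Fin K) ℂ)
    (i : Fin K) (g : ℝ) : Prop :=
  Tendsto (fun P : ℝ => rate (P ^ (-ε)) (ν P) (T P) i / Real.logb 2 P) atTop (𝓝 g)

/-- No family of precoders, even with full knowledge of the channel at all TXs, has more than `g`
as upper limit of `R_i / log₂ P` at RX `i`. -/
def IsMultiplexingGainBound {K : ℕ} (ε : ℝ) (i : Fin K) (g : ℝ) : Prop :=
  ∀ (Ω : ℝ → Type) [∀ P, MeasurableSpace (Ω P)] (ν : (P : ℝ) → Measure (Ω P))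
    [∀ P, IsProbabilityMeasure (ν P)]
    (T : (P : ℝ) → (Fin K → Fin K → ℂ) → Ω P → Matrix (Fin K) (Fin K) ℂ),
    IsPrecodingFamily T → ∀ δ > 0, ∀ᶠ P : ℝ in atTop,
      rate (P ^ (-ε)) (ν P) (T P) i / Real.logb 2 P ≤ g + δ

/-- The decaying allocation `max (2 log₂ (P μ^(2|i-j|))) 0`. -/
def decayingBits {K : ℕ} (μ P : ℝ) (i j : Fin K) : ℝ :=
  max (2 * Real.logb 2 (P * μ ^ (2 * idxDist i j))) 0

end Wyner

end

namespace Wyner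

section LinearAlgebra

variable {K : ℕ}

theorem idxDist_self (i : Fin K) : idxDist i i = 0 := by simp [idxDist]

theorem idxDist_eq_zero {i k : Fin K} : idxDist i k = 0 ↔ i = k := by
  simp only [idxDist, Fin.ext_iff]; omega

theorem idxDist_comm (i k : Fin K) : idxDist i k = idxDist k i := by
  simp only [idxDist]; omega

theorem idxDist_triangle (i k l : Fin K) : idxDist i l ≤ idxDist i k + idxDist k l := by
  simp only [idxDist]; omega

theorem idxDist_le (i k : Fin K) : idxDist i k ≤ K := by
  simp only [idxDist]; omega

theorem l2norm_eq_norm (v : Fin K → ℂ) : l2norm v = ‖WithLp.toLp 2 v‖ := by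
  simp [l2norm, EuclideanSpace.norm_eq]

theorem l2norm_nonneg (v : Fin K → ℂ) : 0 ≤ l2norm v := Real.sqrt_nonneg _

theorem l2norm_sq (v : Fin K → ℂ) : l2norm v ^ 2 = ∑ k, ‖v k‖ ^ 2 :=
  Real.sq_sqrt (Finset.sum_nonneg fun _ _ => by positivity)

theorem norm_le_l2norm (v : Fin K → ℂ) (k : Fin K) : ‖v k‖ ≤ l2norm v := by
  rw [l2norm_eq_norm]
  exact PiLp.norm_apply_le (WithLp.toLp 2 v) k

theorem l2norm_le_sum (v : Fin K → ℂ) : l2norm v ≤ ∑ k, ‖v k‖ := by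
  refine Real.sqrt_le_iff.mpr ⟨Finset.sum_nonneg fun _ _ => norm_nonneg _, ?_⟩
  exact Finset.sum_sq_le_sq_sum_of_nonneg fun _ _ => norm_nonneg _

theorem abs_l2norm_sub_le (v w : Fin K → ℂ) :
    |l2norm v - l2norm w| ≤ ∑ k, ‖v k - w k‖ := by
  refine le_trans ?_ (l2norm_le_sum (fun k => v k - w k))
  simp only [l2norm_eq_norm]
  exact abs_norm_sub_norm_le _ _

theorem norm_profile_le {μ : ℝ} (h0 : 0 < μ) (i k : Fin K) :
    ‖profile μ i k‖ ≤ μ ^ idxDist i k := by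
  unfold profile
  split_ifs with h h'
  · simp [h]
  · simp [h', abs_of_pos h0]
  · simp only [norm_zero]; positivity

theorem norm_profile_le_one {μ : ℝ} (h0 : 0 < μ) (h1 : μ ≤ 1) (i k : Fin K) :
    ‖profile μ i k‖ ≤ 1 :=
  (norm_profile_le h0 i k).trans (pow_le_one₀ h0.le h1)

theorem norm_wynerMatrix_le {μ R : ℝ} (h0 : 0 < μ) (h1 : μ ≤ 1) {F : Fin K → Fin K → ℂ}
    (hF : ∀ i k, ‖F i k‖ ≤ R) (i k : Fin K) : ‖wynerMatrix μ F i k‖ ≤ R := by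
  simp only [wynerMatrix, Matrix.of_apply, norm_mul]
  calc _ ≤ 1 * ‖F i k‖ := by gcongr; exact norm_profile_le_one h0 h1 i k
    _ ≤ R := by simpa using hF i k

/-- Solutions of a weakly coupled tridiagonal system with right-hand side supported at `i` decay
exponentially away from `i`. -/
theorem norm_solution_le {μ r R ρ c : ℝ} (hμ : 0 < μ) (hr : 0 < r) (hR : 0 ≤ R)
    (hρ : 0 < ρ) (hρ' : 2 * (K * R) ≤ r * ρ) (hρμ : ρ * μ ≤ 1) (hc : 0 ≤ c)
    {F : Fin K → Fin K → ℂ} (hd : ∀ i, r ≤ ‖F i i‖) (hF : ∀ i k, ‖F i k‖ ≤ R)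
    (x : Fin K → ℂ) (i : Fin K)
    (hx : ∀ k, ‖(wynerMatrix μ F).mulVec x k‖ ≤ if k = i then c else 0) (k : Fin K) :
    ‖x k‖ ≤ 2 * c / r * (ρ * μ) ^ idxDist k i := by
  have hpos : ∀ k, 0 < (ρ * μ) ^ idxDist k i := fun k => by positivity
  have : Nonempty (Fin K) := ⟨i⟩
  obtain ⟨k₀, hk₀⟩ := Finite.exists_max fun k => ‖x k‖ / (ρ * μ) ^ idxDist k i
  set m := ‖x k₀‖ / (ρ * μ) ^ idxDist k₀ i with hm
  have hm0 : 0 ≤ m := by positivity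
  have hxm : ∀ k, ‖x k‖ ≤ m * (ρ * μ) ^ idxDist k i := fun k => (div_le_iff₀ (hpos k)).1 (hk₀ k)
  have hxk₀ : ‖x k₀‖ = m * (ρ * μ) ^ idxDist k₀ i := by
    rw [hm, div_mul_cancel₀ _ (hpos k₀).ne']
  suffices m ≤ 2 * c / r from
    (hxm k).trans (mul_le_mul_of_nonneg_right this (hpos k).le)
  set W := (ρ * μ) ^ idxDist k₀ i with hW
  have hWpos : 0 < W := hpos k₀
  have hsplit : (wynerMatrix μ F).mulVec x k₀ = F k₀ k₀ * x k₀
      + ∑ l ∈ Finset.univ.erase k₀, wynerMatrix μ F k₀ l * x l := by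
    rw [Matrix.mulVec, dotProduct, ← Finset.add_sum_erase _ _ (Finset.mem_univ k₀)]
    simp [wynerMatrix, profile, idxDist_self]
  have hterm : ∀ l ∈ Finset.univ.erase k₀, ‖wynerMatrix μ F k₀ l * x l‖ ≤ R * m * W / ρ := by
    intro l hl
    have hne : idxDist k₀ l ≠ 0 := by
      rw [Ne, idxDist_eq_zero]; exact fun h => (Finset.ne_of_mem_erase hl) h.symm
    by_cases h1 : idxDist k₀ l = 1
    · have hle : (ρ * μ) ^ idxDist l i * (ρ * μ) ≤ W := by
        rw [← pow_succ]
        refine pow_le_pow_of_le_one (by positivity) hρμ ?_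
        have := idxDist_triangle k₀ l i
        omega
      have : ‖wynerMatrix μ F k₀ l * x l‖ = μ * ‖F k₀ l‖ * ‖x l‖ := by
        simp [wynerMatrix, profile, h1, abs_of_pos hμ]
      rw [this, le_div_iff₀ hρ]
      calc μ * ‖F k₀ l‖ * ‖x l‖ * ρ ≤ μ * R * (m * (ρ * μ) ^ idxDist l i) * ρ := by
            gcongr
            · exact hF _ _
            · exact hxm l
        _ = R * m * ((ρ * μ) ^ idxDist l i * (ρ * μ)) := by ring
        _ ≤ R * m * W := by gcongr
    · have : wynerMatrix μ F k₀ l = 0 := by simp [wynerMatrix, profile, hne, h1]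
      rw [this]; simp only [zero_mul, norm_zero]; positivity
  have hsum : ‖∑ l ∈ Finset.univ.erase k₀, wynerMatrix μ F k₀ l * x l‖ ≤ r * (m * W) / 2 := by
    calc _ ≤ ∑ l ∈ Finset.univ.erase k₀, ‖wynerMatrix μ F k₀ l * x l‖ := norm_sum_le _ _
      _ ≤ ∑ l ∈ Finset.univ.erase k₀, R * m * W / ρ := Finset.sum_le_sum hterm
      _ ≤ ∑ l : Fin K, R * m * W / ρ :=
          Finset.sum_le_sum_of_subset_of_nonneg (Finset.erase_subset _ _)
            fun _ _ _ => by positivity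
      _ = K * R * (m * W) / ρ := by simp; ring
      _ ≤ r * (m * W) / 2 := by
          rw [div_le_div_iff₀ hρ two_pos]
          nlinarith [mul_nonneg hm0 hWpos.le]
  have hmain : r * (m * W) ≤ (if k₀ = i then c else 0) + r * (m * W) / 2 := by
    calc r * (m * W) ≤ ‖F k₀ k₀ * x k₀‖ := by
          rw [norm_mul, hxk₀]; gcongr; exact hd _
      _ = ‖(wynerMatrix μ F).mulVec x k₀
            - ∑ l ∈ Finset.univ.erase k₀, wynerMatrix μ F k₀ l * x l‖ := by
          rw [hsplit, add_sub_cancel_right]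
      _ ≤ _ := (norm_sub_le _ _).trans (add_le_add (hx k₀) hsum)
  rw [le_div_iff₀ hr]
  by_cases h : k₀ = i
  · have : W = 1 := by rw [hW, h, idxDist_self, pow_zero]
    rw [if_pos h, this] at hmain
    linarith
  · rw [if_neg h] at hmain
    have : r * (m * W) ≤ 0 := by linarith
    have : m ≤ 0 := by
      by_contra hcon
      push Not at hcon
      have : 0 < r * (m * W) := by positivity
      linarith
    nlinarith

theorem isUnit_det_wynerMatrix {μ r R ρ : ℝ} (hμ : 0 < μ) (hr : 0 < r) (hR : 0 ≤ R)
    (hρ : 0 < ρ) (hρ' : 2 * (K * R) ≤ r * ρ) (hρμ : ρ * μ ≤ 1)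
    {F : Fin K → Fin K → ℂ} (hd : ∀ i, r ≤ ‖F i i‖) (hF : ∀ i k, ‖F i k‖ ≤ R) :
    IsUnit (wynerMatrix μ F).det := by
  rw [isUnit_iff_ne_zero]
  intro h
  obtain ⟨x, hx0, hx⟩ := Matrix.exists_mulVec_eq_zero_iff.2 h
  refine hx0 (funext fun k => ?_)
  have := norm_solution_le hμ hr hR hρ hρ' hρμ le_rfl hd hF x k (fun l => by simp [hx]) k
  simpa using this

theorem norm_inv_wynerMatrix_le {μ r R ρ : ℝ} (hμ : 0 < μ) (hr : 0 < r) (hR : 0 ≤ R)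
    (hρ : 1 ≤ ρ) (hρ' : 2 * (K * R) ≤ r * ρ) (hρμ : ρ * μ ≤ 1)
    {F : Fin K → Fin K → ℂ} (hd : ∀ i, r ≤ ‖F i i‖) (hF : ∀ i k, ‖F i k‖ ≤ R) (k i : Fin K) :
    ‖(wynerMatrix μ F)⁻¹ k i‖ ≤ 2 / r * ρ ^ K * μ ^ idxDist k i := by
  have hu := isUnit_det_wynerMatrix hμ hr hR (by positivity) hρ' hρμ hd hF
  have := norm_solution_le hμ hr hR (by positivity) hρ' hρμ zero_le_one hd hF
    (fun l => (wynerMatrix μ F)⁻¹ l i) i (fun l => by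
      have : (wynerMatrix μ F).mulVec (fun l => (wynerMatrix μ F)⁻¹ l i) l
          = (wynerMatrix μ F * (wynerMatrix μ F)⁻¹) l i := by
        simp [Matrix.mulVec, dotProduct, Matrix.mul_apply]
      rw [this, Matrix.mul_nonsing_inv _ hu, Matrix.one_apply]
      split_ifs <;> simp) k
  refine this.trans ?_
  rw [mul_pow, mul_one, ← mul_assoc]
  gcongr
  exact idxDist_le _ _

/-- Perturbation of an inverse with exponential off-diagonal decay. The error of row `l` may be as
large as `μ ^ (-|l - j|)`. -/
theorem norm_inv_sub_inv_le {A B : Matrix (Fin K) (Fin K) ℂ} (hA : IsUnit A.det)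
    (hB : IsUnit B.det) {C δ μ : ℝ} (hμ : 0 < μ) (hμ1 : μ ≤ 1) (hC : 0 ≤ C)
    (hAinv : ∀ k i, ‖A⁻¹ k i‖ ≤ C * μ ^ idxDist k i)
    (hBinv : ∀ k i, ‖B⁻¹ k i‖ ≤ C * μ ^ idxDist k i) (j : Fin K)
    (hAB : ∀ l m, ‖(B - A) l m‖ * μ ^ idxDist l j ≤ δ * μ ^ idxDist l m)
    (k i : Fin K) (p : ℕ) (hp : ∀ l, idxDist l j ≤ idxDist k l + idxDist l i + p) :
    ‖A⁻¹ k i - B⁻¹ k i‖ * μ ^ p ≤ K * (K * (C ^ 2 * δ)) := by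
  have hid : A⁻¹ - B⁻¹ = A⁻¹ * ((B - A) * B⁻¹) := by
    rw [Matrix.sub_mul, Matrix.mul_nonsing_inv _ hB, Matrix.mul_sub, ← Matrix.mul_assoc,
      Matrix.nonsing_inv_mul _ hA, Matrix.mul_one, Matrix.one_mul]
  have hexp : A⁻¹ k i - B⁻¹ k i = ∑ l, ∑ m, A⁻¹ k l * ((B - A) l m * B⁻¹ m i) := by
    rw [← Matrix.sub_apply, hid, Matrix.mul_apply]
    simp only [Matrix.mul_apply, Finset.mul_sum]
  have hterm : ∀ l m, ‖A⁻¹ k l * ((B - A) l m * B⁻¹ m i)‖ * μ ^ p ≤ C ^ 2 * δ := by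
    intro l m
    have hkey : ‖(B - A) l m‖ * μ ^ (idxDist k l + idxDist m i + p) ≤ δ := by
      have hpos : 0 < μ ^ idxDist l m := by positivity
      refine le_of_mul_le_mul_right ?_ hpos
      calc ‖(B - A) l m‖ * μ ^ (idxDist k l + idxDist m i + p) * μ ^ idxDist l m
          = ‖(B - A) l m‖ * μ ^ (idxDist k l + idxDist m i + p + idxDist l m) := by
            rw [pow_add _ _ (idxDist l m), mul_assoc]
        _ ≤ ‖(B - A) l m‖ * μ ^ idxDist l j := by
            gcongr ?_ * ?_
            refine pow_le_pow_of_le_one hμ.le hμ1 ?_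
            have := hp l
            have := idxDist_triangle l m i
            omega
        _ ≤ _ := hAB l m
    rw [norm_mul, norm_mul]
    calc ‖A⁻¹ k l‖ * (‖(B - A) l m‖ * ‖B⁻¹ m i‖) * μ ^ p
        ≤ (C * μ ^ idxDist k l) * (‖(B - A) l m‖ * (C * μ ^ idxDist m i)) * μ ^ p := by
          gcongr
          · exact hAinv _ _
          · exact hBinv _ _
      _ = C ^ 2 * (‖(B - A) l m‖ * μ ^ (idxDist k l + idxDist m i + p)) := by
          rw [pow_add, pow_add]; ring
      _ ≤ _ := by gcongr
  calc ‖A⁻¹ k i - B⁻¹ k i‖ * μ ^ p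
      ≤ (∑ l, ∑ m, ‖A⁻¹ k l * ((B - A) l m * B⁻¹ m i)‖) * μ ^ p := by
        rw [hexp]
        gcongr
        exact (norm_sum_le _ _).trans (Finset.sum_le_sum fun l _ => norm_sum_le _ _)
    _ = ∑ l, ∑ m, ‖A⁻¹ k l * ((B - A) l m * B⁻¹ m i)‖ * μ ^ p := by
        rw [Finset.sum_mul]; simp only [Finset.sum_mul]
    _ ≤ ∑ _l : Fin K, ∑ _m : Fin K, C ^ 2 * δ :=
        Finset.sum_le_sum fun l _ => Finset.sum_le_sum fun m _ => hterm l m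
    _ = _ := by simp

/-- Columns of the inverse of a matrix with bounded entries are bounded away from zero. -/
theorem one_le_mul_l2norm_inv {A : Matrix (Fin K) (Fin K) ℂ} (hA : IsUnit A.det) {R : ℝ}
    (hAR : ∀ i k, ‖A i k‖ ≤ R) (i : Fin K) : 1 ≤ K * R * l2norm (fun k => A⁻¹ k i) := by
  have h1 : ∑ k, A i k * A⁻¹ k i = 1 := by
    rw [← Matrix.mul_apply, Matrix.mul_nonsing_inv _ hA, Matrix.one_apply_eq]
  calc (1 : ℝ) = ‖∑ k, A i k * A⁻¹ k i‖ := by rw [h1, norm_one]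
    _ ≤ ∑ k, ‖A i k * A⁻¹ k i‖ := norm_sum_le _ _
    _ ≤ ∑ _k : Fin K, R * l2norm (fun k => A⁻¹ k i) := by
        refine Finset.sum_le_sum fun k _ => ?_
        rw [norm_mul]
        have hR : 0 ≤ R := (norm_nonneg _).trans (hAR i k)
        gcongr
        · exact hAR _ _
        · exact norm_le_l2norm (fun k => A⁻¹ k i) k
    _ = _ := by simp; ring

theorem norm_div_sub_div_le {a b : ℂ} {α β κ : ℝ} (hκ : 0 < κ) (hα : κ⁻¹ ≤ α) (hβ : κ⁻¹ ≤ β) :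
    ‖a / (α : ℂ) - b / (β : ℂ)‖ ≤ κ * ‖a - b‖ + κ ^ 2 * (‖b‖ * |β - α|) := by
  have hκ' : 0 < κ⁻¹ := inv_pos.2 hκ
  have hα0 : 0 < α := hκ'.trans_le hα
  have hβ0 : 0 < β := hκ'.trans_le hβ
  have hαc : (α : ℂ) ≠ 0 := by exact_mod_cast hα0.ne'
  have hβc : (β : ℂ) ≠ 0 := by exact_mod_cast hβ0.ne'
  have hid : a / (α : ℂ) - b / (β : ℂ)
      = (α⁻¹ : ℝ) * (a - b) + (α⁻¹ * β⁻¹ : ℝ) * (b * ((β - α : ℝ) : ℂ)) := by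
    push_cast; field_simp; ring
  have hαi : α⁻¹ ≤ κ := inv_le_of_inv_le₀ hκ hα
  have hβi : β⁻¹ ≤ κ := inv_le_of_inv_le₀ hκ hβ
  rw [hid]
  refine (norm_add_le _ _).trans ?_
  rw [norm_mul, norm_mul, norm_mul, Complex.norm_real, Complex.norm_real, Complex.norm_real,
    Real.norm_of_nonneg (by positivity), Real.norm_of_nonneg (by positivity), Real.norm_eq_abs,
    sq]
  gcongr

/-- The zero forcing coefficients of TX `j` computed from two channels whose difference in row `l`
is of order `μ ^ (-|l - j|) / √P` differ by a bounded amount. -/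
theorem norm_zfPrecoder_sub_le {A B : Matrix (Fin K) (Fin K) ℂ} (hA : IsUnit A.det)
    (hB : IsUnit B.det) {C M R μ P : ℝ} (hP : 0 < P) (hμ : 0 < μ) (hμ1 : μ ≤ 1) (hC : 0 ≤ C)
    (hR : 0 < R) (hAR : ∀ i k, ‖A i k‖ ≤ R) (hBR : ∀ i k, ‖B i k‖ ≤ R)
    (hAinv : ∀ k i, ‖A⁻¹ k i‖ ≤ C * μ ^ idxDist k i)
    (hBinv : ∀ k i, ‖B⁻¹ k i‖ ≤ C * μ ^ idxDist k i) (j : Fin K)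
    (hAB : ∀ l m, ‖(B - A) l m‖ * μ ^ idxDist l j ≤ M / √P * μ ^ idxDist l m) (i : Fin K) :
    ‖zfPrecoder P A j i - zfPrecoder P B j i‖
      ≤ (K * R + (K * R) ^ 2 * (C * K)) * (K * (K * (C ^ 2 * M))) := by
  have hsP : 0 < √P := Real.sqrt_pos.2 hP
  have hK : (0 : ℝ) < K := by exact_mod_cast (Fin.pos i)
  have hκ : 0 < K * R := by positivity
  have hα := one_le_mul_l2norm_inv hA hAR i
  have hβ := one_le_mul_l2norm_inv hB hBR i
  rw [← div_le_iff₀' hκ, one_div] at hα hβ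
  set E := K * (K * (C ^ 2 * (M / √P))) with hE
  have hji : ‖A⁻¹ j i - B⁻¹ j i‖ ≤ E := by
    have := norm_inv_sub_inv_le hA hB hμ hμ1 hC hAinv hBinv j hAB j i 0
      (fun l => by have := idxDist_comm l j; omega)
    simpa using this
  have hnorm : ‖B⁻¹ j i‖ * |l2norm (fun k => B⁻¹ k i) - l2norm (fun k => A⁻¹ k i)|
      ≤ C * K * E := by
    calc _ ≤ (C * μ ^ idxDist j i) * ∑ k, ‖A⁻¹ k i - B⁻¹ k i‖ := by
          gcongr
          · exact hBinv _ _
          · rw [abs_sub_comm]; exact abs_l2norm_sub_le _ _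
      _ = C * ∑ k, ‖A⁻¹ k i - B⁻¹ k i‖ * μ ^ idxDist j i := by
          rw [← Finset.sum_mul]; ring
      _ ≤ C * ∑ _k : Fin K, E := by
          gcongr with k
          refine norm_inv_sub_inv_le hA hB hμ hμ1 hC hAinv hBinv j hAB k i _ fun l => ?_
          have := idxDist_triangle l i j
          have := idxDist_comm i j
          omega
      _ = C * K * E := by simp; ring
  have h := norm_div_sub_div_le (a := A⁻¹ j i) (b := B⁻¹ j i) hκ hα hβ
  simp only [zfPrecoder, Matrix.of_apply]
  rw [← mul_sub, norm_mul, Complex.norm_real, Real.norm_of_nonneg hsP.le]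
  calc √P * _ ≤ √P * (K * R * E + (K * R) ^ 2 * (C * K * E)) := by
        refine mul_le_mul_of_nonneg_left (h.trans ?_) hsP.le
        gcongr
    _ = _ := by rw [hE]; field_simp

/-- Signal to interference and noise ratio of a precoder at bounded distance from the zero forcing
precoder of a channel with rescaled rows. -/
theorem le_sinr_of_norm_sub_zfPrecoder_le {H B T : Matrix (Fin K) (Fin K) ℂ} {u : Fin K → ℂ}
    {P R L U β : ℝ} (hP : 0 < P) (hR : 0 ≤ R) (hU : 0 < U) (hβ : 0 < β)
    (hu0 : ∀ i, u i ≠ 0) (hu : ∀ i, ‖u i‖ ≤ U) (hBH : ∀ i k, B i k = u i * H i k)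
    (hB : IsUnit B.det) (hH : ∀ i k, ‖H i k‖ ≤ R)
    (hT : ∀ j l, ‖T j l - zfPrecoder P B j l‖ ≤ L)
    (hBβ : ∀ i, l2norm (fun k => B⁻¹ k i) ≤ β)
    (hPL : 2 * (K * (R * L)) * (U * β) ≤ √P) (i : Fin K) :
    (1 / (2 * (U * β))) ^ 2 / (1 + K * (K * (R * L)) ^ 2) * P ≤ sinr H T i := by
  have hsP : 0 < √P := Real.sqrt_pos.2 hP
  have hHT : ∀ l, ‖(H * T) i l - (H * zfPrecoder P B) i l‖ ≤ K * (R * L) := by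
    intro l
    rw [Matrix.mul_apply, Matrix.mul_apply, ← Finset.sum_sub_distrib]
    calc _ ≤ ∑ j, ‖H i j * T j l - H i j * zfPrecoder P B j l‖ := norm_sum_le _ _
      _ ≤ ∑ _j : Fin K, R * L := by
          refine Finset.sum_le_sum fun j _ => ?_
          rw [← mul_sub, norm_mul]
          exact mul_le_mul (hH i j) (hT j l) (norm_nonneg _) hR
      _ = K * (R * L) := by simp
  have hHzf : ∀ l, (H * zfPrecoder P B) i l
      = (u i)⁻¹ * (√P / (l2norm (fun k => B⁻¹ k l) : ℂ)) * (1 : Matrix (Fin K) (Fin K) ℂ) i l := by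
    intro l
    rw [← Matrix.mul_nonsing_inv _ hB, Matrix.mul_apply, Matrix.mul_apply, Finset.mul_sum]
    refine Finset.sum_congr rfl fun k _ => ?_
    rw [hBH, zfPrecoder, Matrix.of_apply]
    have := hu0 i
    field_simp
  have hcol : 0 < l2norm (fun k => B⁻¹ k i) := by
    refine (l2norm_nonneg _).lt_of_ne' fun h0 => ?_
    have := one_le_mul_l2norm_inv (R := U * R) hB
      (fun i k => by rw [hBH, norm_mul]; gcongr; exacts [hu i, hH i k]) i
    rw [h0] at this
    norm_num at this
  have hsig : √P / (U * β) ≤ ‖(H * zfPrecoder P B) i i‖ := by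
    have hupos : 0 < ‖u i‖ := norm_pos_iff.2 (hu0 i)
    rw [hHzf, Matrix.one_apply_eq, mul_one, norm_mul, norm_inv, norm_div, Complex.norm_real,
      Complex.norm_real, Real.norm_of_nonneg hsP.le, Real.norm_of_nonneg hcol.le,
      ← div_eq_inv_mul, div_div, mul_comm U β]
    gcongr
    · exact hBβ i
    · exact hu i
  have hsig' : √P / (2 * (U * β)) ≤ ‖(H * T) i i‖ := by
    have h1 := norm_sub_norm_le ((H * zfPrecoder P B) i i) ((H * T) i i)
    rw [norm_sub_rev] at h1
    have h2 := hHT i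
    have h3 : K * (R * L) ≤ √P / (2 * (U * β)) := by
      rw [le_div_iff₀ (by positivity)]; linarith
    have h4 : √P / (U * β) = √P / (2 * (U * β)) + √P / (2 * (U * β)) := by field_simp; ring
    linarith
  have hint : ∑ l ∈ Finset.univ.erase i, ‖(H * T) i l‖ ^ 2 ≤ K * (K * (R * L)) ^ 2 := by
    calc _ ≤ ∑ l ∈ Finset.univ.erase i, (K * (R * L)) ^ 2 := by
          refine Finset.sum_le_sum fun l hl => ?_
          have hne : i ≠ l := (Finset.ne_of_mem_erase hl).symm
          have := hHT l
          rw [hHzf, Matrix.one_apply_ne hne, mul_zero, sub_zero] at this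
          exact pow_le_pow_left₀ (norm_nonneg _) this 2
      _ ≤ ∑ _l : Fin K, (K * (R * L)) ^ 2 :=
          Finset.sum_le_sum_of_subset_of_nonneg (Finset.erase_subset _ _)
            fun _ _ _ => by positivity
      _ = _ := by simp
  have h0 : 0 ≤ ∑ l ∈ Finset.univ.erase i, ‖(H * T) i l‖ ^ 2 :=
    Finset.sum_nonneg fun _ _ => by positivity
  unfold sinr
  calc _ = (√P / (2 * (U * β))) ^ 2 / (1 + K * (K * (R * L)) ^ 2) := by
        rw [div_pow √P, Real.sq_sqrt hP.le, one_div, inv_pow]; ring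
    _ ≤ _ := by gcongr

/-- If the estimates of row `l` at TX `j` have errors of order `μ ^ (-|l - j|) / √P`, then
distributed zero forcing has a signal to interference and noise ratio of order `P`. -/
theorem exists_le_sinr {r R U M : ℝ} (hr : 0 < r) (hR : 0 < R) (hU : 0 < U) (hM : 0 ≤ M) :
    ∃ c > 0, ∃ μ₀ > 0, ∃ P₀ : ℝ, ∀ μ P : ℝ, 0 < μ → μ ≤ 1 → μ ≤ μ₀ → 0 < P → P₀ ≤ P →
      ∀ (G : Fin K → Fin K → ℂ) (u : Fin K → ℂ) (F : Fin K → Fin K → Fin K → ℂ),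
      (∀ i k, ‖G i k‖ ≤ R) → (∀ i, u i ≠ 0) → (∀ i, ‖u i‖ ≤ U) →
      (∀ i k, ‖u i * G i k‖ ≤ R) → (∀ i, r ≤ ‖u i * G i i‖) →
      (∀ j i k, ‖F j i k‖ ≤ R) → (∀ j i, r ≤ ‖F j i i‖) →
      (∀ j l m, idxDist l m ≤ 1 → ‖u l * G l m - F j l m‖ * μ ^ idxDist l j ≤ M / √P) →
      ∀ i, c * P ≤ sinr (wynerMatrix μ G)
        (Matrix.of fun j i => zfPrecoder P (wynerMatrix μ (F j)) j i) i := by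
  obtain ⟨ρ, hρ1, hρ2⟩ : ∃ ρ : ℝ, 1 ≤ ρ ∧ 2 * (K * R) ≤ r * ρ :=
    ⟨max 1 (2 * (K * R) / r), le_max_left _ _, by
      rw [← div_le_iff₀' hr]; exact le_max_right _ _⟩
  obtain ⟨C, hC, hCdef⟩ : ∃ C : ℝ, 0 < C ∧ 2 / r * ρ ^ K = C := ⟨_, by positivity, rfl⟩
  obtain ⟨L, hL0, hL⟩ : ∃ L : ℝ, 0 ≤ L ∧
    (K * R + (K * R) ^ 2 * (C * K)) * (K * (K * (C ^ 2 * M))) = L := ⟨_, by positivity, rfl⟩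
  have hβ : 0 < (K + 1) * C := by positivity
  refine ⟨(1 / (2 * (U * ((K + 1) * C)))) ^ 2 / (1 + K * (K * (R * L)) ^ 2), by positivity, ρ⁻¹,
    by positivity, (2 * (K * (R * L)) * (U * ((K + 1) * C))) ^ 2, ?_⟩
  intro μ P hμ hμ1 hμ₀ hP hP₀ G u F hG hu0 hu hΓ hΓd hF hFd herr i
  have hρμ : ρ * μ ≤ 1 := by
    rw [← le_div_iff₀' (by positivity), one_div]; exact hμ₀
  have hsP : 0 < √P := Real.sqrt_pos.2 hP
  have hinv : ∀ {E : Fin K → Fin K → ℂ}, (∀ i, r ≤ ‖E i i‖) → (∀ i k, ‖E i k‖ ≤ R) →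
      IsUnit (wynerMatrix μ E).det ∧
        ∀ k i, ‖(wynerMatrix μ E)⁻¹ k i‖ ≤ C * μ ^ idxDist k i := fun hd hE =>
    ⟨isUnit_det_wynerMatrix hμ hr hR.le (by positivity) hρ2 hρμ hd hE, by
      rw [← hCdef]; exact norm_inv_wynerMatrix_le hμ hr hR.le hρ1 hρ2 hρμ hd hE⟩
  obtain ⟨hBunit, hBinv⟩ := hinv (E := fun l m => u l * G l m) hΓd hΓ
  refine le_sinr_of_norm_sub_zfPrecoder_le (B := wynerMatrix μ fun l m => u l * G l m) hP hR.le hU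
    hβ hu0 hu (fun i k => ?_) hBunit (norm_wynerMatrix_le hμ hμ1 hG) (fun j l => ?_) (fun i => ?_)
    (Real.le_sqrt_of_sq_le hP₀) i
  · simp only [wynerMatrix, Matrix.of_apply]; ring
  · obtain ⟨hAunit, hAinv⟩ := hinv (hFd j) (hF j)
    rw [← hL, Matrix.of_apply]
    refine norm_zfPrecoder_sub_le hAunit hBunit hP hμ hμ1 hC.le hR
      (norm_wynerMatrix_le hμ hμ1 (hF j)) (norm_wynerMatrix_le hμ hμ1 hΓ) hAinv hBinv j ?_ l
    intro a m
    have hsub : (wynerMatrix μ (fun l m => u l * G l m) - wynerMatrix μ (F j)) a m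
        = profile μ a m * (u a * G a m - F j a m) := by
      simp only [wynerMatrix, Matrix.sub_apply, Matrix.of_apply]; ring
    rw [hsub, norm_mul]
    by_cases ham : idxDist a m ≤ 1
    · calc _ = ‖profile μ a m‖ * (‖u a * G a m - F j a m‖ * μ ^ idxDist a j) := by ring
        _ ≤ μ ^ idxDist a m * (M / √P) :=
            mul_le_mul (norm_profile_le hμ a m) (herr j a m ham) (by positivity) (by positivity)
        _ = _ := by ring
    · have : profile μ a m = 0 := by
        unfold profile; rw [if_neg (by omega), if_neg (by omega)]
      rw [this]; simp only [norm_zero, zero_mul]; positivity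
  · calc _ ≤ ∑ k, ‖(wynerMatrix μ fun l m => u l * G l m)⁻¹ k i‖ := l2norm_le_sum _
      _ ≤ ∑ _k : Fin K, C := by
          refine Finset.sum_le_sum fun k _ => (hBinv k i).trans ?_
          exact mul_le_of_le_one_right hC.le (pow_le_one₀ hμ.le hμ1)
      _ = K * C := by simp
      _ ≤ _ := by nlinarith

end LinearAlgebra

section Quantization

variable {K : ℕ}

theorem exists_rvqSelect_eq {N : ℕ} [NeZero N] (W : Fin N → Fin K → ℂ) (g : Fin K → ℂ) :
    ∃ n, rvqSelect W g = W n ∧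
      ∀ m, ‖∑ k, star (W m k) * g k‖ ≤ ‖∑ k, star (W n k) * g k‖ := by
  refine ⟨_, rfl, ?_⟩
  have := Finset.min'_mem _ (maximizers_nonempty fun n => ‖∑ k, star (W n k) * g k‖)
  simpa only [maximizers, Finset.mem_filter, Finset.mem_univ, true_and] using this

theorem l2norm_sub_sq (w g : Fin K → ℂ) (hw : l2norm w = 1) (a : ℂ) :
    l2norm (fun k => g k - a * w k) ^ 2
      = l2norm g ^ 2 - ‖∑ k, star (w k) * g k‖ ^ 2 + ‖(∑ k, star (w k) * g k) - a‖ ^ 2 := by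
  have hin : inner ℂ (WithLp.toLp 2 w) (WithLp.toLp 2 g) = ∑ k, star (w k) * g k := by
    simp [PiLp.inner_apply, mul_comm]
  have hsub : WithLp.toLp 2 (fun k => g k - a * w k)
      = WithLp.toLp 2 g - a • WithLp.toLp 2 w := by
    ext k; simp
  rw [l2norm_eq_norm] at hw
  rw [l2norm_eq_norm, l2norm_eq_norm, hsub, norm_sub_sq (𝕜 := ℂ), norm_smul, hw, mul_one,
    inner_smul_right, ← inner_conj_symm, hin]
  rw [norm_sub_sq (𝕜 := ℂ) (∑ k, star (w k) * g k) a]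
  simp only [RCLike.inner_apply]
  ring

/-- The unit scalar that rotates `z` to the nonnegative real axis. -/
noncomputable def unphase (z : ℂ) : ℂ := Complex.exp (-(Complex.arg z) * Complex.I)

theorem norm_unphase (z : ℂ) : ‖unphase z‖ = 1 := by
  unfold unphase
  have := Complex.norm_exp_ofReal_mul_I (-(Complex.arg z))
  push_cast at this
  exact this

theorem unphase_mul_self (z : ℂ) : unphase z * z = ‖z‖ := by
  calc unphase z * z
      = unphase z * (‖z‖ * Complex.exp (Complex.arg z * Complex.I)) := by
        rw [Complex.norm_mul_exp_arg_mul_I]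
    _ = ‖z‖ := by
        unfold unphase
        rw [mul_left_comm, ← Complex.exp_add]
        simp

theorem norm_fixPhase (i : Fin K) (w : Fin K → ℂ) (k : Fin K) : ‖fixPhase i w k‖ = ‖w k‖ := by
  have : fixPhase i w k = unphase (w i) * w k := rfl
  rw [this, norm_mul, norm_unphase, one_mul]

/-- A unit vector that is nearly aligned with `g` is close, after fixing the phases, to the
direction of `g`. -/
theorem norm_direction_sub_fixPhase_le {w g : Fin K → ℂ} (hw : l2norm w = 1) {i : Fin K}
    {r Γ τ : ℝ} (hr : 0 < r) (hτ : 0 ≤ τ) (hτr : τ ≤ r / 2) (hgi : r ≤ ‖g i‖) (hg : l2norm g ≤ Γ)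
    (h : l2norm g ^ 2 - ‖∑ k, star (w k) * g k‖ ^ 2 ≤ τ ^ 2) :
    r / (2 * Γ) ≤ ‖w i‖ ∧
      ∀ k, ‖unphase (g i) / (l2norm g : ℂ) * g k - fixPhase i w k‖ ≤ (2 + 4 * Γ / r) / r * τ := by
  set α := ∑ k, star (w k) * g k with hα
  set γ := l2norm g with hγ
  have hrγ : r ≤ γ := hgi.trans (norm_le_l2norm g i)
  have hγ0 : 0 < γ := hr.trans_le hrγ
  have hΓ0 : 0 < Γ := hγ0.trans_le hg
  have hid := l2norm_sub_sq w g hw α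
  rw [sub_self, norm_zero, zero_pow two_ne_zero, add_zero, ← hγ, ← hα] at hid
  have hαγ : ‖α‖ ≤ γ := by
    have : ‖α‖ ^ 2 ≤ γ ^ 2 := by
      have := sq_nonneg (l2norm fun k => g k - α * w k)
      linarith
    exact abs_le_of_sq_le_sq' this hγ0.le |>.2
  have herr : ∀ k, ‖g k - α * w k‖ ≤ τ := fun k =>
    (norm_le_l2norm (fun k => g k - α * w k) k).trans
      (abs_le_of_sq_le_sq' (hid.trans_le h) hτ).2
  have hγα : γ - ‖α‖ ≤ τ := by
    refine (abs_le_of_sq_le_sq' ?_ hτ).2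
    nlinarith [norm_nonneg α]
  have hwi : r / (2 * Γ) ≤ ‖w i‖ := by
    rw [div_le_iff₀ (by positivity)]
    have h1 : ‖g i‖ ≤ τ + ‖α‖ * ‖w i‖ := by
      have := norm_sub_norm_le (g i) (α * w i)
      rw [norm_mul] at this
      linarith [herr i]
    have h2 : ‖α‖ * ‖w i‖ ≤ Γ * ‖w i‖ := by gcongr; linarith
    linarith
  refine ⟨hwi, fun k => ?_⟩
  have hwk : ∀ k, ‖w k‖ ≤ 1 := fun k => hw ▸ norm_le_l2norm w k
  have hrot : ‖unphase (g i) * α - ‖α‖ * unphase (w i)‖ ≤ 4 * Γ / r * τ := by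
    have h1 : ‖(unphase (g i) * α - ‖α‖ * unphase (w i)) * w i‖ ≤ 2 * τ := by
      have : (unphase (g i) * α - ‖α‖ * unphase (w i)) * w i
          = -(unphase (g i) * (g i - α * w i)) + ((‖g i‖ - ‖α * w i‖ : ℝ) : ℂ) := by
        push_cast
        rw [norm_mul, ← unphase_mul_self (g i), Complex.ofReal_mul, ← unphase_mul_self (w i)]
        ring
      rw [this]
      refine (norm_add_le _ _).trans ?_
      rw [norm_neg, norm_mul, norm_unphase, one_mul, Complex.norm_real, Real.norm_eq_abs]
      have := abs_norm_sub_norm_le (g i) (α * w i)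
      linarith [herr i]
    rw [norm_mul] at h1
    have h2 : 0 ≤ ‖unphase (g i) * α - ‖α‖ * unphase (w i)‖ := norm_nonneg _
    have h3 := (mul_le_mul_of_nonneg_left hwi h2).trans h1
    rw [mul_div_assoc', div_le_iff₀ (by positivity)] at h3
    rw [div_mul_eq_mul_div, le_div_iff₀ hr]
    linarith
  have hγc : (γ : ℂ) ≠ 0 := by exact_mod_cast hγ0.ne'
  have hdec : unphase (g i) / (γ : ℂ) * g k - fixPhase i w k
      = ((γ⁻¹ : ℝ) : ℂ) * (unphase (g i) * (g k - α * w k)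
        + (unphase (g i) * α - ‖α‖ * unphase (w i)) * w k
        - ((γ - ‖α‖ : ℝ) : ℂ) * (unphase (w i) * w k)) := by
    have : fixPhase i w k = unphase (w i) * w k := rfl
    rw [this]
    push_cast
    field_simp
    ring
  rw [hdec, norm_mul, Complex.norm_real, norm_inv, Real.norm_of_nonneg hγ0.le]
  have hA : ‖unphase (g i) * (g k - α * w k)‖ ≤ τ := by
    rw [norm_mul, norm_unphase, one_mul]; exact herr k
  have hB : ‖(unphase (g i) * α - ‖α‖ * unphase (w i)) * w k‖ ≤ 4 * Γ / r * τ := by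
    rw [norm_mul]
    calc _ ≤ 4 * Γ / r * τ * 1 := by gcongr; exact hwk k
      _ = _ := mul_one _
  have hC : ‖((γ - ‖α‖ : ℝ) : ℂ) * (unphase (w i) * w k)‖ ≤ τ := by
    rw [norm_mul, norm_mul, norm_unphase, one_mul, Complex.norm_real,
      Real.norm_of_nonneg (by linarith)]
    calc _ ≤ τ * 1 := by gcongr; exact hwk k
      _ = _ := mul_one _
  calc _ ≤ r⁻¹ * (τ + 4 * Γ / r * τ + τ) := by
        gcongr
        exact (norm_sub_le _ _).trans (add_le_add ((norm_add_le _ _).trans (add_le_add hA hB)) hC)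
    _ = _ := by ring

instance : IsProbabilityMeasure stdComplexGaussian := by
  unfold stdComplexGaussian
  exact Measure.isProbabilityMeasure_map
    (Complex.measurableEquivRealProd.symm.measurable.aemeasurable)

theorem exists_le_gaussianReal_Ioo (M : ℝ) :
    ∃ c > 0, ∀ a, |a| ≤ M → ∀ s, 0 < s → s ≤ 1 →
      ENNReal.ofReal (c * s) ≤ gaussianReal 0 (1 / 2) (Set.Ioo (a - s / 2) (a + s / 2)) := by
  have hv : (1 / 2 : NNReal) ≠ 0 := by norm_num
  refine ⟨gaussianPDFReal 0 (1 / 2) (|M| + 1), gaussianPDFReal_pos _ _ _ hv, ?_⟩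
  intro a ha s hs hs1
  rw [gaussianReal_apply _ hv]
  calc ENNReal.ofReal (gaussianPDFReal 0 (1 / 2) (|M| + 1) * s)
      = ∫⁻ _x in Set.Ioo (a - s / 2) (a + s / 2), gaussianPDF 0 (1 / 2) (|M| + 1) := by
        rw [setLIntegral_const, Real.volume_Ioo, gaussianPDF,
          ← ENNReal.ofReal_mul (gaussianPDFReal_nonneg _ _ _)]
        congr 1; ring
    _ ≤ _ := by
        refine setLIntegral_mono' measurableSet_Ioo fun x hx => ENNReal.ofReal_le_ofReal ?_
        unfold gaussianPDFReal
        have hxM : |x| ≤ |M| + 1 := by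
          have := le_abs_self M
          rw [abs_le] at ha ⊢
          constructor <;> linarith [hx.1, hx.2]
        gcongr ?_ * Real.exp (-?_ / _)
        rw [sub_zero, sub_zero]
        exact sq_le_sq' (by linarith [(abs_le.1 hxM).1]) (abs_le.1 hxM).2

/-- The mass of small discs with center in a bounded set is of the order of their area. -/
theorem exists_le_stdComplexGaussian_ball (M : ℝ) :
    ∃ c > 0, ∀ z : ℂ, ‖z‖ ≤ M → ∀ s, 0 < s → s ≤ 1 →
      ENNReal.ofReal (c * s ^ 2) ≤ stdComplexGaussian (Metric.ball z s) := by
  obtain ⟨c, hc, h⟩ := exists_le_gaussianReal_Ioo M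
  refine ⟨c ^ 2, by positivity, fun z hz s hs hs1 => ?_⟩
  have hre := h z.re ((Complex.abs_re_le_norm z).trans hz) s hs hs1
  have him := h z.im ((Complex.abs_im_le_norm z).trans hz) s hs hs1
  have hm : Measurable fun p : ℝ × ℝ => (⟨p.1, p.2⟩ : ℂ) :=
    Complex.measurableEquivRealProd.symm.measurable
  refine le_trans ?_ (Measure.le_map_apply hm.aemeasurable _)
  calc ENNReal.ofReal (c ^ 2 * s ^ 2) = ENNReal.ofReal (c * s) * ENNReal.ofReal (c * s) := by
        rw [← ENNReal.ofReal_mul (by positivity)]; congr 1; ring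
    _ ≤ _ := mul_le_mul' hre him
    _ = _ := (Measure.prod_prod _ _).symm
    _ ≤ _ := by
        refine measure_mono fun p hp => ?_
        simp only [Set.mem_prod, Set.mem_Ioo] at hp
        simp only [Set.mem_preimage, Metric.mem_ball, dist_eq_norm]
        refine (Complex.norm_le_abs_re_add_abs_im _).trans_lt ?_
        have h1 : |p.1 - z.re| < s / 2 := by rw [abs_lt]; constructor <;> linarith [hp.1.1, hp.1.2]
        have h2 : |p.2 - z.im| < s / 2 := by rw [abs_lt]; constructor <;> linarith [hp.2.1, hp.2.2]
        simp only [Complex.sub_re, Complex.sub_im]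
        linarith

theorem card_neighbors_le {n : ℕ} (i : Fin (n + 1)) :
    (Finset.univ.filter fun k : Fin n => idxDist i (i.succAbove k) ≤ 1).card ≤ 2 := by
  have hsub : (Finset.univ.filter fun k : Fin n => idxDist i (i.succAbove k) ≤ 1).image
      (fun k => (i.succAbove k : ℕ)) ⊆ {(i : ℕ) + 1, (i : ℕ) - 1} := by
    intro m hm
    simp only [Finset.mem_image, Finset.mem_filter, Finset.mem_univ, true_and] at hm
    obtain ⟨k, hk, rfl⟩ := hm
    have hne := Fin.succAbove_ne i k
    rw [Ne, Fin.ext_iff] at hne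
    simp only [idxDist] at hk
    simp only [Finset.mem_insert, Finset.mem_singleton]
    omega
  rw [← Finset.card_image_of_injective _
    (fun a b hab => Fin.succAbove_right_injective (Fin.ext hab) : Function.Injective
      fun k : Fin n => (i.succAbove k : ℕ))]
  exact (Finset.card_le_card hsub).trans Finset.card_le_two

/-- Mass of the cone-like sets of vectors whose ratios to the `i`-th entry are prescribed up to an
error of order `s` in the (at most two) neighboring positions. -/
theorem exists_le_pi_gaussian_cone (i : Fin K) (Q : ℝ) :
    ∃ c > 0, ∀ q : Fin K → ℂ, (∀ k, ‖q k‖ ≤ Q) → ∀ s, 0 < s → s ≤ 1 →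
      ENNReal.ofReal (c * s ^ 4) ≤ (Measure.pi fun _ : Fin K => stdComplexGaussian)
        {v | 1 < ‖v i‖ ∧ ∀ k, k ≠ i → idxDist i k ≤ 1 → ‖v k - v i * q k‖ < s} := by
  obtain _ | n := K
  · exact i.elim0
  obtain ⟨c₁, hc₁, h₁⟩ := exists_le_stdComplexGaussian_ball (3 / 2)
  obtain ⟨c₂, hc₂, h₂⟩ := exists_le_stdComplexGaussian_ball (2 * Q)
  set c₃ := min c₂ 1 with hc₃
  have hc₃0 : 0 < c₃ := lt_min hc₂ one_pos
  refine ⟨c₁ * (1 / 2) ^ 2 * c₃ ^ 2, by positivity, fun q hq s hs hs1 => ?_⟩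
  let U : ℂ → Fin n → Set ℂ := fun z k =>
    if idxDist i (i.succAbove k) ≤ 1 then Metric.ball (z * q (i.succAbove k)) s else Set.univ
  let S : Set (ℂ × (Fin n → ℂ)) := {p | p.1 ∈ Metric.ball (3 / 2 : ℂ) (1 / 2) ∧ ∀ k,
    idxDist i (i.succAbove k) ≤ 1 → dist (p.2 k) (p.1 * q (i.succAbove k)) < s}
  have hS : MeasurableSet S := by
    have : S = Prod.fst ⁻¹' Metric.ball (3 / 2 : ℂ) (1 / 2) ∩
        ⋂ k, ⋂ _ : idxDist i (i.succAbove k) ≤ 1,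
          {p : ℂ × (Fin n → ℂ) | dist (p.2 k) (p.1 * q (i.succAbove k)) < s} := by
      ext p; simp [S]
    rw [this]
    refine MeasurableSet.inter (measurable_fst Metric.isOpen_ball.measurableSet) ?_
    refine MeasurableSet.iInter fun k => MeasurableSet.iInter fun _ => ?_
    exact (isOpen_lt (by fun_prop) (by fun_prop)).measurableSet
  have hmp := measurePreserving_piFinSuccAbove (fun _ : Fin (n + 1) => stdComplexGaussian) i
  have hball : ∀ z ∈ Metric.ball (3 / 2 : ℂ) (1 / 2), 1 < ‖z‖ ∧ ‖z‖ < 2 := by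
    intro z hz
    rw [Metric.mem_ball, dist_eq_norm] at hz
    have h1 := norm_sub_norm_le (3 / 2 : ℂ) z
    have h2 := norm_sub_norm_le z (3 / 2 : ℂ)
    rw [norm_sub_rev] at h1
    have h3 : ‖(3 / 2 : ℂ)‖ = 3 / 2 := by norm_num
    constructor <;> linarith
  have hsec : ∀ z ∈ Metric.ball (3 / 2 : ℂ) (1 / 2),
      ENNReal.ofReal (c₃ ^ 2 * s ^ 4) ≤ (Measure.pi fun _ : Fin n => stdComplexGaussian)
        (Prod.mk z ⁻¹' S) := by
    intro z hz
    have hset : Prod.mk z ⁻¹' S = Set.univ.pi (U z) := by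
      ext p
      simp only [S, U, Set.mem_preimage, Set.mem_ofPred_eq, Set.mem_pi, Set.mem_univ, true_imp_iff]
      constructor
      · rintro ⟨-, h⟩ k
        split_ifs with hk
        · exact h k hk
        · trivial
      · refine fun h => ⟨hz, fun k hk => ?_⟩
        have := h k
        rwa [if_pos hk] at this
    rw [hset, Measure.pi_pi]
    have hone : ENNReal.ofReal (c₃ * s ^ 2) ≤ 1 := by
      rw [ENNReal.ofReal_le_one]
      have h1 : c₃ ≤ 1 := min_le_right _ _
      have h2 : s ^ 2 ≤ 1 := pow_le_one₀ hs.le hs1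
      nlinarith [sq_nonneg s]
    calc ENNReal.ofReal (c₃ ^ 2 * s ^ 4) = ENNReal.ofReal (c₃ * s ^ 2) ^ 2 := by
          rw [← ENNReal.ofReal_pow (by positivity)]; congr 1; ring
      _ ≤ ENNReal.ofReal (c₃ * s ^ 2) ^
            (Finset.univ.filter fun k : Fin n => idxDist i (i.succAbove k) ≤ 1).card :=
          pow_le_pow_right_of_le_one' hone (card_neighbors_le i)
      _ = ∏ k : Fin n, if idxDist i (i.succAbove k) ≤ 1 then ENNReal.ofReal (c₃ * s ^ 2) else 1 := by
          rw [← Finset.prod_filter, Finset.prod_const]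
      _ ≤ ∏ k, stdComplexGaussian (U z k) := by
          refine Finset.prod_le_prod' fun k _ => ?_
          simp only [U]
          split_ifs with hk
          · refine le_trans (ENNReal.ofReal_le_ofReal ?_) (h₂ _ ?_ s hs hs1)
            · gcongr; exact min_le_left _ _
            · rw [norm_mul]
              exact mul_le_mul (hball z hz).2.le (hq _) (norm_nonneg _) two_pos.le
          · rw [measure_univ]
  calc ENNReal.ofReal (c₁ * (1 / 2) ^ 2 * c₃ ^ 2 * s ^ 4)
      = ENNReal.ofReal (c₃ ^ 2 * s ^ 4) * ENNReal.ofReal (c₁ * (1 / 2) ^ 2) := by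
        rw [← ENNReal.ofReal_mul (by positivity)]; congr 1; ring
    _ ≤ ENNReal.ofReal (c₃ ^ 2 * s ^ 4) * stdComplexGaussian (Metric.ball (3 / 2 : ℂ) (1 / 2)) := by
        gcongr
        exact h₁ _ (by norm_num) _ (by norm_num) (by norm_num)
    _ = ∫⁻ _z in Metric.ball (3 / 2 : ℂ) (1 / 2), ENNReal.ofReal (c₃ ^ 2 * s ^ 4)
          ∂stdComplexGaussian := by rw [setLIntegral_const]
    _ ≤ ∫⁻ z in Metric.ball (3 / 2 : ℂ) (1 / 2),
          (Measure.pi fun _ : Fin n => stdComplexGaussian) (Prod.mk z ⁻¹' S)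
          ∂stdComplexGaussian := setLIntegral_mono' Metric.isOpen_ball.measurableSet hsec
    _ ≤ ∫⁻ z, (Measure.pi fun _ : Fin n => stdComplexGaussian) (Prod.mk z ⁻¹' S)
          ∂stdComplexGaussian := setLIntegral_le_lintegral _ _
    _ = (stdComplexGaussian.prod (Measure.pi fun _ : Fin n => stdComplexGaussian)) S :=
        (Measure.prod_apply hS).symm
    _ = (Measure.pi fun _ : Fin (n + 1) => stdComplexGaussian)
          (MeasurableEquiv.piFinSuccAbove (fun _ => ℂ) i ⁻¹' S) :=
        (hmp.measure_preimage hS.nullMeasurableSet).symm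
    _ ≤ _ := by
        refine measure_mono fun v hv => ?_
        have hv1 : v i ∈ Metric.ball (3 / 2 : ℂ) (1 / 2) := hv.1
        refine ⟨(hball _ hv1).1, fun k hk hik => ?_⟩
        obtain ⟨k, rfl⟩ := Fin.exists_succAbove_eq hk
        rw [← dist_eq_norm]
        exact hv.2 k hik

end Quantization

section CodewordLaw

variable {K : ℕ}

@[fun_prop]
theorem measurable_l2norm : Measurable (l2norm : (Fin K → ℂ) → ℝ) := by
  unfold l2norm; fun_prop

@[fun_prop]
theorem measurable_mask (i : Fin K) : Measurable (mask i) := by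
  refine measurable_pi_lambda _ fun k => ?_
  unfold mask
  split_ifs <;> fun_prop

/-- Direction of the part of a vector at the positions of the nonzero entries of row `i`. -/
noncomputable def maskDirection (i : Fin K) (v : Fin K → ℂ) : Fin K → ℂ :=
  fun k => mask i v k / (l2norm (mask i v) : ℂ)

theorem measurable_maskDirection (i : Fin K) : Measurable (maskDirection i) := by
  refine measurable_pi_lambda _ fun k => ?_
  unfold maskDirection
  have h1 := measurable_mask i
  have h2 : Measurable fun v => mask i v k := (measurable_pi_apply k).comp h1
  exact h2.div (Complex.measurable_ofReal.comp (measurable_l2norm.comp h1))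

theorem codewordLaw_eq (i : Fin K) : codewordLaw i
    = (Measure.pi fun _ : Fin K => stdComplexGaussian).map (maskDirection i) := rfl

instance (i : Fin K) : IsProbabilityMeasure (codewordLaw i) := by
  rw [codewordLaw_eq]
  exact Measure.isProbabilityMeasure_map (measurable_maskDirection i).aemeasurable

theorem norm_mask_le (i : Fin K) (v : Fin K → ℂ) (k : Fin K) : ‖mask i v k‖ ≤ ‖v k‖ := by
  unfold mask; split_ifs <;> simp

theorem mask_apply_self (i : Fin K) (v : Fin K → ℂ) : mask i v i = v i := by
  simp [mask, idxDist_self]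

theorem l2norm_le_of_norm_le {v : Fin K → ℂ} {R : ℝ} (hv : ∀ k, ‖v k‖ ≤ R) :
    l2norm v ≤ K * R := by
  calc _ ≤ ∑ k, ‖v k‖ := l2norm_le_sum v
    _ ≤ ∑ _k : Fin K, R := Finset.sum_le_sum fun k _ => hv k
    _ = _ := by simp

theorem norm_le_l2norm_mask (i : Fin K) (v : Fin K → ℂ) : ‖v i‖ ≤ l2norm (mask i v) := by
  have := norm_le_l2norm (mask i v) i
  rwa [mask_apply_self] at this

theorem l2norm_maskDirection {i : Fin K} {v : Fin K → ℂ} (hv : v i ≠ 0) :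
    l2norm (maskDirection i v) = 1 := by
  have hpos : 0 < l2norm (mask i v) := (norm_pos_iff.2 hv).trans_le (norm_le_l2norm_mask i v)
  have h : l2norm (maskDirection i v) ^ 2 = 1 := by
    rw [l2norm_sq]
    simp only [maskDirection, norm_div, Complex.norm_real, Real.norm_of_nonneg hpos.le, div_pow]
    rw [← Finset.sum_div, ← l2norm_sq]
    exact div_self (by positivity)
  exact (pow_eq_one_iff_of_nonneg (l2norm_nonneg _) two_ne_zero).1 h

instance : NullSingletonClass stdComplexGaussian := by
  have := nullSingletonClass_gaussianReal (μ := 0) (v := 1 / 2) (by norm_num)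
  constructor
  intro z
  have hm : Measurable fun p : ℝ × ℝ => (⟨p.1, p.2⟩ : ℂ) :=
    Complex.measurableEquivRealProd.symm.measurable
  rw [stdComplexGaussian, Measure.map_apply hm (measurableSet_singleton z)]
  have : (fun p : ℝ × ℝ => (⟨p.1, p.2⟩ : ℂ)) ⁻¹' {z} = {(z.re, z.im)} := by
    ext p; simp [Complex.ext_iff, Prod.ext_iff]
  rw [this, ← Set.singleton_prod_singleton, Measure.prod_prod, measure_singleton,
    zero_mul]

theorem ae_codewordLaw_l2norm (i : Fin K) : ∀ᵐ w ∂codewordLaw i, l2norm w = 1 := by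
  rw [codewordLaw_eq, ae_map_iff (measurable_maskDirection i).aemeasurable
    (measurableSet_eq_fun measurable_l2norm measurable_const)]
  filter_upwards [Measure.ae_eval_ne (fun _ : Fin K => stdComplexGaussian) i 0] with v hv
  exact l2norm_maskDirection hv

/-- The probability that a random codeword captures the direction of `g` up to an angle of order
`s` is at least of order `s ^ 4`. -/
theorem exists_le_codewordLaw (i : Fin K) {r R : ℝ} (hr : 0 < r) (hR : 0 ≤ R) :
    ∃ c > 0, ∀ g : Fin K → ℂ, r ≤ ‖g i‖ → (∀ k, ‖g k‖ ≤ R) → (∀ k, 1 < idxDist i k → g k = 0) →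
      ∀ s, 0 < s → s ≤ 1 → ENNReal.ofReal (c * s ^ 4) ≤ codewordLaw i
        {w | l2norm g ^ 2 - ‖∑ k, star (w k) * g k‖ ^ 2 ≤ K * (R * s) ^ 2} := by
  obtain ⟨c, hc, h⟩ := exists_le_pi_gaussian_cone i (R / r)
  refine ⟨c, hc, fun g hgi hgR hg0 s hs hs1 => ?_⟩
  have hgi0 : g i ≠ 0 := norm_pos_iff.1 (hr.trans_le hgi)
  refine (h (fun k => g k / g i) (fun k => ?_) s hs hs1).trans ?_
  · rw [norm_div]; gcongr; exact hgR k
  rw [codewordLaw_eq]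
  refine le_trans (measure_mono ?_) (Measure.le_map_apply
    (measurable_maskDirection i).aemeasurable _)
  rintro v ⟨hv1, hv⟩
  have hvi0 : v i ≠ 0 := norm_pos_iff.1 (one_pos.trans hv1)
  have hpos : 0 < l2norm (mask i v) := (norm_pos_iff.2 hvi0).trans_le (norm_le_l2norm_mask i v)
  have hposc : (l2norm (mask i v) : ℂ) ≠ 0 := by exact_mod_cast hpos.ne'
  have hid := l2norm_sub_sq (maskDirection i v) g (l2norm_maskDirection hvi0)
    (g i / v i * l2norm (mask i v))
  have hle : l2norm (fun k => g k - g i / v i * l2norm (mask i v) * maskDirection i v k) ^ 2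
      ≤ K * (R * s) ^ 2 := by
    rw [l2norm_sq]
    calc _ ≤ ∑ _k : Fin K, (R * s) ^ 2 := by
          refine Finset.sum_le_sum fun k _ => pow_le_pow_left₀ (norm_nonneg _) ?_ 2
          have h1 : g k - g i / v i * l2norm (mask i v) * maskDirection i v k
              = g k - g i / v i * mask i v k := by
            unfold maskDirection; field_simp
          rw [h1]
          by_cases hk : idxDist i k ≤ 1
          · have h2 : mask i v k = v k := by simp [mask, hk]
            rw [h2]
            by_cases hki : k = i
            · rw [hki, div_mul_cancel₀ _ hvi0, sub_self, norm_zero]; positivity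
            · have h3 : g k - g i / v i * v k = -(g i / v i * (v k - v i * (g k / g i))) := by
                field_simp; ring
              rw [h3, norm_neg, norm_mul, norm_div]
              have h4 := (hv k hki hk).le
              have h5 : ‖g i‖ / ‖v i‖ ≤ R :=
                (div_le_self (norm_nonneg _) hv1.le).trans (hgR i)
              gcongr
          · have h2 : mask i v k = 0 := by simp [mask, hk]
            rw [h2, hg0 k (by omega)]
            simp only [mul_zero, sub_zero, norm_zero]; positivity
      _ = _ := by simp
  have := sq_nonneg ‖∑ k, star (maskDirection i v k) * g k - g i / v i * l2norm (mask i v)‖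
  simp only [Set.mem_preimage, Set.mem_ofPred_eq]
  linarith

theorem measurableSet_norm_lt_or_lt (r R : ℝ) :
    MeasurableSet {z : ℂ | ‖z‖ < r ∨ R < ‖z‖} := by
  have : {z : ℂ | ‖z‖ < r ∨ R < ‖z‖} = {z | ‖z‖ < r} ∪ {z | R < ‖z‖} := by ext; simp
  rw [this]
  exact (measurableSet_lt measurable_norm measurable_const).union
    (measurableSet_lt measurable_const measurable_norm)

/-- Discs and complements of discs exhaust the mass of the Gaussian law. -/
theorem exists_stdComplexGaussian_tail_le {η : ENNReal} (hη : 0 < η) :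
    ∃ r > 0, ∃ R ≥ 1, r ≤ 1 ∧ stdComplexGaussian {z | ‖z‖ < r ∨ R < ‖z‖} ≤ η := by
  let s : ℕ → Set ℂ := fun n => {z | ‖z‖ < 1 / (n + 1 : ℝ) ∨ (n + 1 : ℝ) < ‖z‖}
  have hanti : Antitone s := by
    intro m n hmn z hz
    have hmn' : (m : ℝ) + 1 ≤ n + 1 := by exact_mod_cast Nat.succ_le_succ hmn
    rcases hz with hz | hz
    · exact Or.inl (hz.trans_le (one_div_le_one_div_of_le (by positivity) hmn'))
    · exact Or.inr (hmn'.trans_lt hz)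
  have hmeas : ∀ n, MeasurableSet (s n) := fun n => measurableSet_norm_lt_or_lt _ _
  have hlim := tendsto_measure_iInter_atTop (μ := stdComplexGaussian) (s := s)
    (fun n => (hmeas n).nullMeasurableSet) hanti ⟨0, measure_ne_top _ _⟩
  have hzero : stdComplexGaussian (⋂ n, s n) = 0 := by
    refine measure_mono_null (t := {0}) (fun z hz => ?_) (measure_singleton 0)
    by_contra hz0
    have hpos : 0 < ‖z‖ := norm_pos_iff.2 hz0
    obtain ⟨n, hn⟩ := exists_nat_gt (max ‖z‖ (1 / ‖z‖))
    rcases Set.mem_iInter.1 hz n with h | h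
    · rw [lt_one_div hpos (by positivity)] at h
      have := (le_max_right _ _).trans_lt hn
      linarith
    · have := (le_max_left _ _).trans_lt hn
      linarith
  rw [hzero] at hlim
  obtain ⟨n, hn⟩ := (hlim.eventually (ge_mem_nhds hη)).exists
  refine ⟨1 / (n + 1 : ℝ), by positivity, n + 1, by simp, ?_, hn⟩
  rw [div_le_one (by positivity)]; simp

theorem codewordLaw_norm_lt_le (i : Fin K) {r R : ℝ} (hr : 0 < r) :
    codewordLaw i {w | ‖w i‖ < r / (K * R)}
      ≤ K * stdComplexGaussian {z | ‖z‖ < r ∨ R < ‖z‖} := by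
  have hK : (0 : ℝ) < K := by exact_mod_cast Fin.pos i
  rw [codewordLaw_eq, Measure.map_apply (measurable_maskDirection i)
    (isOpen_lt (by fun_prop) (by fun_prop)).measurableSet]
  have hsub : maskDirection i ⁻¹' {w | ‖w i‖ < r / (K * R)}
      ⊆ ⋃ k, Function.eval k ⁻¹' {z | ‖z‖ < r ∨ R < ‖z‖} := by
    intro v hv
    by_contra hcon
    have hgood : ∀ k, r ≤ ‖v k‖ ∧ ‖v k‖ ≤ R := by
      intro k
      have : ¬(‖v k‖ < r ∨ R < ‖v k‖) := fun h => hcon (Set.mem_iUnion.2 ⟨k, h⟩)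
      push Not at this
      exact this
    have hpos : 0 < l2norm (mask i v) :=
      (hr.trans_le (hgood i).1).trans_le (norm_le_l2norm_mask i v)
    have hle : l2norm (mask i v) ≤ K * R :=
      l2norm_le_of_norm_le fun k => (norm_mask_le i v k).trans (hgood k).2
    have hv' : ‖maskDirection i v i‖ < r / (K * R) := hv
    rw [maskDirection, mask_apply_self, norm_div, Complex.norm_real,
      Real.norm_of_nonneg hpos.le] at hv'
    refine absurd hv' (not_lt.2 ?_)
    gcongr
    exact (hgood i).1
  refine (measure_mono hsub).trans ((measure_iUnion_le _).trans ?_)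
  rw [tsum_fintype]
  have hm := measurableSet_norm_lt_or_lt r R
  simp only [(measurePreserving_eval (fun _ : Fin K => stdComplexGaussian) _).measure_preimage
    hm.nullMeasurableSet]
  simp

instance (b : Fin K → Fin K → ℕ) : IsProbabilityMeasure (codebookLaw b) := by
  unfold codebookLaw; infer_instance

theorem measurePreserving_codebook (b : Fin K → Fin K → ℕ) (i j : Fin K) :
    MeasurePreserving (fun c : Codebooks b => c i j) (codebookLaw b)
      (Measure.pi fun _ => codewordLaw i) :=
  (measurePreserving_eval (fun j => Measure.pi fun _ : Fin (2 ^ b i j) => codewordLaw i) j).comp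
    (measurePreserving_eval
      (fun i => Measure.pi fun j => Measure.pi fun _ : Fin (2 ^ b i j) => codewordLaw i) i)

theorem measurePreserving_codeword (b : Fin K → Fin K → ℕ) (i j : Fin K) (n : Fin (2 ^ b i j)) :
    MeasurePreserving (fun c : Codebooks b => c i j n) (codebookLaw b) (codewordLaw i) :=
  (measurePreserving_eval (fun _ : Fin (2 ^ b i j) => codewordLaw i) n).comp
    (measurePreserving_codebook b i j)

theorem ae_codebook_l2norm (b : Fin K → Fin K → ℕ) (i j : Fin K) :
    ∀ᵐ c ∂codebookLaw b, ∀ n, l2norm (c i j n) = 1 := by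
  rw [ae_all_iff]
  intro n
  exact (measurePreserving_codeword b i j n).quasiMeasurePreserving.ae (ae_codewordLaw_l2norm i)

/-- Probability that none of the codewords falls into a given set. -/
theorem codebookLaw_forall_notMem_le (b : Fin K → Fin K → ℕ) (i j : Fin K)
    {S : Set (Fin K → ℂ)} (hS : MeasurableSet S) {p : ℝ} (hp0 : 0 ≤ p)
    (hp : ENNReal.ofReal p ≤ codewordLaw i S) :
    codebookLaw b {c | ∀ n, c i j n ∉ S} ≤ ENNReal.ofReal (Real.exp (-(p * 2 ^ b i j))) := by
  have hset : {c : Codebooks b | ∀ n, c i j n ∉ S}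
      = (fun c : Codebooks b => c i j) ⁻¹' (Set.univ.pi fun _ => Sᶜ) := by
    ext c; simp
  rw [hset, (measurePreserving_codebook b i j).measure_preimage
    (MeasurableSet.univ_pi fun _ => hS.compl).nullMeasurableSet, Measure.pi_pi, Finset.prod_const,
    Finset.card_univ, Fintype.card_fin, prob_compl_eq_one_sub hS]
  calc (1 - codewordLaw i S) ^ 2 ^ b i j ≤ (1 - ENNReal.ofReal p) ^ 2 ^ b i j := by gcongr
    _ ≤ ENNReal.ofReal (Real.exp (-p)) ^ 2 ^ b i j := by
        gcongr
        rw [← ENNReal.ofReal_one, ← ENNReal.ofReal_sub _ hp0]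
        exact ENNReal.ofReal_le_ofReal (Real.one_sub_le_exp_neg p)
    _ = _ := by
        rw [← ENNReal.ofReal_pow (Real.exp_nonneg _), ← Real.exp_nat_mul]
        congr 2; push_cast; ring

end CodewordLaw

section Measurability

variable {K : ℕ} {Ω : Type*} [MeasurableSpace Ω]

theorem measurable_rvqSelect {N : ℕ} [NeZero N] {W : Ω → Fin N → Fin K → ℂ}
    {g : Ω → Fin K → ℂ} (hW : Measurable W) (hg : Measurable g) :
    Measurable fun x => rvqSelect (W x) (g x) := by
  let s : Ω → Fin N → ℝ := fun x n => ‖∑ k, star (W x n k) * g x k‖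
  have hs : ∀ n, Measurable fun x => s x n := fun n => by
    have h1 : ∀ k, Measurable fun x => W x n k := fun k => by fun_prop
    have h2 : ∀ k, Measurable fun x => g x k := fun k => by fun_prop
    exact (Finset.measurable_sum _ fun k _ =>
      (Complex.continuous_conj.measurable.comp (h1 k)).mul (h2 k)).norm
  let idx : Ω → Fin N := fun x => (maximizers (s x)).min' (maximizers_nonempty _)
  have hmax : ∀ n, MeasurableSet {x | n ∈ maximizers (s x)} := by
    intro n
    have : {x | n ∈ maximizers (s x)} = ⋂ m, {x | s x m ≤ s x n} := by
      ext x; simp [maximizers]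
    rw [this]
    exact MeasurableSet.iInter fun m => measurableSet_le (hs m) (hs n)
  have hidx : ∀ n, MeasurableSet {x | idx x = n} := by
    intro n
    have : {x | idx x = n}
        = {x | n ∈ maximizers (s x)} ∩ ⋂ m, ⋂ _ : m < n, {x | m ∈ maximizers (s x)}ᶜ := by
      ext x
      simp only [Set.mem_inter_iff, Set.mem_iInter, Set.mem_compl_iff, Set.mem_ofPred_eq]
      constructor
      · rintro rfl
        exact ⟨Finset.min'_mem _ _, fun m hm hmem => absurd (Finset.min'_le _ _ hmem) (not_le.2 hm)⟩
      · rintro ⟨h1, h2⟩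
        refine le_antisymm (Finset.min'_le _ _ h1) (not_lt.1 fun hlt => ?_)
        exact h2 _ hlt (Finset.min'_mem _ _)
    rw [this]
    exact (hmax n).inter (MeasurableSet.iInter fun m => MeasurableSet.iInter fun _ =>
      (hmax m).compl)
  have heq : (fun x => rvqSelect (W x) (g x))
      = fun x => ∑ n, {x | idx x = n}.indicator (fun x => W x n) x := by
    funext x
    rw [Finset.sum_eq_single (idx x)]
    · rw [Set.indicator_of_mem (by simp)]; rfl
    · intro n _ hn
      exact Set.indicator_of_notMem (fun h : idx x = n => hn h.symm) _
    · simp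
  rw [heq]
  exact Finset.measurable_sum _ fun n _ =>
    ((measurable_pi_apply n).comp hW).indicator (hidx n)

theorem measurable_unphase : Measurable unphase := by
  unfold unphase; fun_prop

theorem measurable_fixPhase (i : Fin K) : Measurable (fixPhase i) := by
  refine measurable_pi_lambda _ fun k => ?_
  exact (measurable_unphase.comp (measurable_pi_apply i)).mul (measurable_pi_apply k)

theorem measurable_fadingEstimate (b : Fin K → Fin K → ℕ) (j i : Fin K) :
    Measurable fun x : (Fin K → Fin K → ℂ) × Codebooks b => fadingEstimate x.1 x.2 j i := by
  unfold fadingEstimate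
  refine (measurable_fixPhase i).comp (measurable_rvqSelect ?_ ?_)
  · exact (measurable_pi_apply j).comp ((measurable_pi_apply i).comp measurable_snd)
  · exact (measurable_mask i).comp ((measurable_pi_apply i).comp measurable_fst)

theorem measurable_det {A : Ω → Matrix (Fin K) (Fin K) ℂ}
    (hA : ∀ i k, Measurable fun x => A x i k) : Measurable fun x => (A x).det := by
  simp only [Matrix.det_apply]
  refine Finset.measurable_sum _ fun σ _ => ?_
  simp only [Units.smul_def, zsmul_eq_mul]
  exact measurable_const.mul (Finset.measurable_prod _ fun i _ => hA _ _)

theorem measurable_inv_apply {A : Ω → Matrix (Fin K) (Fin K) ℂ}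
    (hA : ∀ i k, Measurable fun x => A x i k) (i k : Fin K) :
    Measurable fun x => (A x)⁻¹ i k := by
  simp only [Matrix.inv_def, Ring.inverse_eq_inv', Matrix.smul_apply, Matrix.adjugate_apply,
    smul_eq_mul]
  refine (measurable_det hA).inv.mul (measurable_det fun a c => ?_)
  simp only [Matrix.updateRow_apply]
  split_ifs
  · exact measurable_const
  · exact hA a c

theorem measurable_zfPrecoder {A : Ω → Matrix (Fin K) (Fin K) ℂ}
    (hA : ∀ i k, Measurable fun x => A x i k) (P : ℝ) (j i : Fin K) :
    Measurable fun x => zfPrecoder P (A x) j i := by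
  simp only [zfPrecoder, Matrix.of_apply]
  refine measurable_const.mul ((measurable_inv_apply hA j i).div ?_)
  exact Complex.measurable_ofReal.comp (measurable_l2norm.comp
    (measurable_pi_lambda _ fun k => measurable_inv_apply hA k i))

theorem measurable_wynerMatrix {F : Ω → Fin K → Fin K → ℂ} (hF : Measurable F) (μ : ℝ)
    (i k : Fin K) : Measurable fun x => wynerMatrix μ (F x) i k := by
  simp only [wynerMatrix, Matrix.of_apply]
  fun_prop

theorem norm_zfPrecoder_le (P : ℝ) (A : Matrix (Fin K) (Fin K) ℂ) (j i : Fin K) :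
    ‖zfPrecoder P A j i‖ ≤ √P := by
  simp only [zfPrecoder, Matrix.of_apply]
  rw [norm_mul, norm_div, Complex.norm_real, Complex.norm_real,
    Real.norm_of_nonneg (Real.sqrt_nonneg _), Real.norm_of_nonneg (l2norm_nonneg _)]
  exact mul_le_of_le_one_right (Real.sqrt_nonneg _)
    (div_le_one_of_le₀ (norm_le_l2norm (fun k => A⁻¹ k i) j) (l2norm_nonneg _))

theorem dcsiPrecoder_apply (μ P : ℝ) {b : Fin K → Fin K → ℕ} (G : Fin K → Fin K → ℂ)
    (c : Codebooks b) (j i : Fin K) : dcsiPrecoder μ P G c j i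
      = zfPrecoder P (wynerMatrix μ (fadingEstimate G c j)) j i := by
  rw [dcsiPrecoder, Matrix.of_apply]

theorem measurable_dcsiPrecoder (μ P : ℝ) (b : Fin K → Fin K → ℕ) (j i : Fin K) :
    Measurable fun x : (Fin K → Fin K → ℂ) × Codebooks b => dcsiPrecoder μ P x.1 x.2 j i := by
  have h : Measurable fun x : (Fin K → Fin K → ℂ) × Codebooks b => fadingEstimate x.1 x.2 j :=
    measurable_pi_lambda _ fun l => measurable_fadingEstimate b j l
  simp only [dcsiPrecoder_apply]
  exact measurable_zfPrecoder (fun i k => measurable_wynerMatrix h μ i k) P j i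

theorem l2norm_dcsiPrecoder_sq_le (μ : ℝ) {P : ℝ} (hP : 0 ≤ P) {b : Fin K → Fin K → ℕ}
    (G : Fin K → Fin K → ℂ) (c : Codebooks b) (i : Fin K) :
    l2norm (fun j => dcsiPrecoder μ P G c j i) ^ 2 ≤ K * P := by
  rw [l2norm_sq]
  calc _ ≤ ∑ _j : Fin K, √P ^ 2 := by
        refine Finset.sum_le_sum fun j _ => pow_le_pow_left₀ (norm_nonneg _) ?_ 2
        rw [dcsiPrecoder_apply]
        exact norm_zfPrecoder_le P _ j i
    _ = _ := by simp [Real.sq_sqrt hP]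

theorem isPrecodingFamily_dcsiPrecoder (b : ℝ → Fin K → Fin K → ℕ) (ε : ℝ) :
    IsPrecodingFamily (K := K) (Ω := fun P => Codebooks (b P))
      (fun P G c => dcsiPrecoder (P ^ (-ε)) P G c) :=
  ⟨K, fun P hP => ⟨measurable_dcsiPrecoder _ P (b P),
    l2norm_dcsiPrecoder_sq_le _ (zero_le_one.trans hP.le)⟩⟩

theorem measurable_sinr {H T : Ω → Matrix (Fin K) (Fin K) ℂ}
    (hH : ∀ i k, Measurable fun x => H x i k) (hT : ∀ i k, Measurable fun x => T x i k)
    (i : Fin K) : Measurable fun x => sinr (H x) (T x) i := by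
  have h : ∀ l, Measurable fun x => ‖(H x * T x) i l‖ ^ 2 := fun l => by
    simp only [Matrix.mul_apply]
    exact (Finset.measurable_sum _ fun k _ => (hH i k).mul (hT k l)).norm.pow_const 2
  unfold sinr
  exact (h i).div (measurable_const.add (Finset.measurable_sum _ fun l _ => h l))

theorem sinr_nonneg (H T : Matrix (Fin K) (Fin K) ℂ) (i : Fin K) : 0 ≤ sinr H T i := by
  unfold sinr
  have : 0 ≤ ∑ l ∈ Finset.univ.erase i, ‖(H * T) i l‖ ^ 2 :=
    Finset.sum_nonneg fun _ _ => by positivity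
  positivity

end Measurability

section UpperBound

variable {K : ℕ}

theorem sinr_le {μ P C : ℝ} (hμ : 0 < μ) (hμ1 : μ ≤ 1) (G : Fin K → Fin K → ℂ)
    (T : Matrix (Fin K) (Fin K) ℂ) (i : Fin K) (hT : l2norm (fun j => T j i) ^ 2 ≤ C * P) :
    sinr (wynerMatrix μ G) T i ≤ l2norm (G i) ^ 2 * (C * P) := by
  have h0 : 0 ≤ ∑ l ∈ Finset.univ.erase i, ‖(wynerMatrix μ G * T) i l‖ ^ 2 :=
    Finset.sum_nonneg fun _ _ => by positivity
  unfold sinr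
  refine (div_le_self (by positivity) (by linarith)).trans ?_
  calc ‖(wynerMatrix μ G * T) i i‖ ^ 2
      ≤ (∑ k, ‖G i k‖ * ‖T k i‖) ^ 2 := by
        refine pow_le_pow_left₀ (norm_nonneg _) ?_ 2
        rw [Matrix.mul_apply]
        refine (norm_sum_le _ _).trans (Finset.sum_le_sum fun k _ => ?_)
        rw [norm_mul]
        gcongr
        simp only [wynerMatrix, Matrix.of_apply, norm_mul]
        exact mul_le_of_le_one_left (norm_nonneg _) (norm_profile_le_one hμ hμ1 i k)
    _ ≤ (∑ k, ‖G i k‖ ^ 2) * ∑ k, ‖T k i‖ ^ 2 := Finset.sum_mul_sq_le_sq_mul_sq _ _ _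
    _ = l2norm (G i) ^ 2 * l2norm (fun j => T j i) ^ 2 := by rw [l2norm_sq, l2norm_sq]
    _ ≤ _ := by gcongr

theorem integrable_normSq_stdComplexGaussian :
    Integrable (fun z : ℂ => ‖z‖ ^ 2) stdComplexGaussian := by
  have hm : Measurable fun p : ℝ × ℝ => (⟨p.1, p.2⟩ : ℂ) :=
    Complex.measurableEquivRealProd.symm.measurable
  rw [stdComplexGaussian, integrable_map_measure (by fun_prop) hm.aemeasurable]
  have hsq : Integrable (fun x : ℝ => x ^ 2) (gaussianReal 0 (1 / 2)) := by
    have := (memLp_id_gaussianReal (μ := 0) (v := 1 / 2) 2).integrable_sq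
    simpa using this
  have h := (hsq.comp_fst (gaussianReal 0 (1 / 2))).add (hsq.comp_snd (gaussianReal 0 (1 / 2)))
  refine h.congr (Eventually.of_forall fun p => ?_)
  simp only [Pi.add_apply, Function.comp_apply, Complex.sq_norm, Complex.normSq_mk]
  ring

instance : IsProbabilityMeasure (fadingLaw K) := by
  unfold fadingLaw; infer_instance

theorem measurePreserving_fading (i k : Fin K) :
    MeasurePreserving (fun G : Fin K → Fin K → ℂ => G i k) (fadingLaw K) stdComplexGaussian :=
  (measurePreserving_eval (fun _ : Fin K => stdComplexGaussian) k).comp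
    (measurePreserving_eval
      (fun _ : Fin K => Measure.pi fun _ : Fin K => stdComplexGaussian) i)

theorem integrable_l2norm_sq_fading (i : Fin K) :
    Integrable (fun G : Fin K → Fin K → ℂ => l2norm (G i) ^ 2) (fadingLaw K) := by
  simp only [l2norm_sq]
  refine integrable_finsetSum _ fun k _ => ?_
  exact (measurePreserving_fading i k).integrable_comp_of_integrable
    integrable_normSq_stdComplexGaussian

theorem logb_one_add_sinr_nonneg (H T : Matrix (Fin K) (Fin K) ℂ) (i : Fin K) :
    0 ≤ Real.logb 2 (1 + sinr H T i) :=
  Real.logb_nonneg one_lt_two (by linarith [sinr_nonneg H T i])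

theorem logb_one_add_sinr_le {μ P C : ℝ} (hμ : 0 < μ) (hμ1 : μ ≤ 1) (hP : 1 < P) (hC : 0 ≤ C)
    (G : Fin K → Fin K → ℂ) (T : Matrix (Fin K) (Fin K) ℂ) (i : Fin K)
    (hT : l2norm (fun j => T j i) ^ 2 ≤ C * P) :
    Real.logb 2 (1 + sinr (wynerMatrix μ G) T i)
      ≤ Real.logb 2 P + C / Real.log 2 * l2norm (G i) ^ 2 := by
  have h1 := sinr_le hμ hμ1 G T i hT
  have h2 := sinr_nonneg (wynerMatrix μ G) T i
  have hlog2 : 0 < Real.log 2 := Real.log_pos one_lt_two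
  have hx : 0 ≤ C * l2norm (G i) ^ 2 := by positivity
  calc Real.logb 2 (1 + sinr (wynerMatrix μ G) T i)
      ≤ Real.logb 2 (P * (1 + C * l2norm (G i) ^ 2)) := by
        refine Real.logb_le_logb_of_le one_lt_two (by linarith) ?_
        nlinarith
    _ = Real.logb 2 P + Real.logb 2 (1 + C * l2norm (G i) ^ 2) :=
        Real.logb_mul (by linarith) (by linarith)
    _ ≤ _ := by
        gcongr
        rw [Real.logb, div_mul_eq_mul_div]
        gcongr
        have := Real.log_le_sub_one_of_pos (show 0 < 1 + C * l2norm (G i) ^ 2 by linarith)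
        linarith

variable {Ω : Type} [MeasurableSpace Ω] {ν : Measure Ω} [IsProbabilityMeasure ν]

theorem integrable_bound (i : Fin K) (a c : ℝ) :
    Integrable (fun x : (Fin K → Fin K → ℂ) × Ω => a + c * l2norm (x.1 i) ^ 2)
      ((fadingLaw K).prod ν) :=
  (integrable_const a).add (((integrable_l2norm_sq_fading i).const_mul c).comp_fst ν)

theorem rate_le {μ P C : ℝ} (hμ : 0 < μ) (hμ1 : μ ≤ 1) (hP : 1 < P) (hC : 0 ≤ C)
    (T : (Fin K → Fin K → ℂ) → Ω → Matrix (Fin K) (Fin K) ℂ) (i : Fin K)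
    (hT : ∀ G ω, l2norm (fun j => T G ω j i) ^ 2 ≤ C * P) :
    rate μ ν T i
      ≤ Real.logb 2 P + C / Real.log 2 * ∫ G, l2norm (G i) ^ 2 ∂fadingLaw K := by
  calc rate μ ν T i ≤ ∫ x, (Real.logb 2 P + C / Real.log 2 * l2norm (x.1 i) ^ 2)
        ∂((fadingLaw K).prod ν) :=
        integral_mono_of_nonneg (Eventually.of_forall fun x => logb_one_add_sinr_nonneg _ _ _)
          (integrable_bound i _ _)
          (Eventually.of_forall fun x => logb_one_add_sinr_le hμ hμ1 hP hC _ _ _ (hT _ _))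
    _ = _ := by
        rw [integral_add (integrable_const _)
          (((integrable_l2norm_sq_fading i).const_mul _).comp_fst ν), integral_const,
          integral_const_mul, integral_fun_fst (fun G : Fin K → Fin K → ℂ => l2norm (G i) ^ 2)]
        simp

theorem integrable_logb_one_add_sinr {μ P C : ℝ} (hμ : 0 < μ) (hμ1 : μ ≤ 1) (hP : 1 < P)
    (hC : 0 ≤ C) {T : (Fin K → Fin K → ℂ) → Ω → Matrix (Fin K) (Fin K) ℂ} (i : Fin K)
    (hm : ∀ j i, Measurable fun x : (Fin K → Fin K → ℂ) × Ω => T x.1 x.2 j i)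
    (hT : ∀ G ω, l2norm (fun j => T G ω j i) ^ 2 ≤ C * P) :
    Integrable (fun x : (Fin K → Fin K → ℂ) × Ω =>
      Real.logb 2 (1 + sinr (wynerMatrix μ x.1) (T x.1 x.2) i)) ((fadingLaw K).prod ν) := by
  refine (integrable_bound i (Real.logb 2 P) (C / Real.log 2)).mono' ?_
    (Eventually.of_forall fun x => ?_)
  · have h := measurable_sinr (measurable_wynerMatrix measurable_fst μ) hm i
    simp only [Real.logb]
    exact ((Real.measurable_log.comp (measurable_const.add h)).div_const _).aestronglyMeasurable
  · rw [Real.norm_of_nonneg (logb_one_add_sinr_nonneg _ _ _)]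
    exact logb_one_add_sinr_le hμ hμ1 hP hC _ _ _ (hT _ _)

theorem tendsto_logb_two_atTop : Tendsto (Real.logb 2) atTop atTop :=
  Real.tendsto_logb_atTop one_lt_two

theorem isMultiplexingGainBound_one {ε : ℝ} (hε : 0 < ε) (i : Fin K) :
    IsMultiplexingGainBound ε i 1 := by
  intro Ω _ ν _ T ⟨C, hC⟩ δ hδ
  set D := max C 0 / Real.log 2 * ∫ G, l2norm (G i) ^ 2 ∂fadingLaw K with hD
  filter_upwards [eventually_gt_atTop 1,
    tendsto_logb_two_atTop.eventually_ge_atTop (D / δ)] with P hP hPD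
  have hlogP : 0 < Real.logb 2 P := Real.logb_pos one_lt_two hP
  have hP0 : 0 < P := by linarith
  rw [div_le_iff₀ hlogP]
  rw [div_le_iff₀ hδ] at hPD
  have := rate_le (ν := ν P) (Real.rpow_pos_of_pos hP0 (-ε))
    (Real.rpow_le_one_of_one_le_of_nonpos hP.le (by linarith)) hP (le_max_right C 0) (T P) i
    (fun G ω => ((hC P hP).2 G ω i).trans (by gcongr; exact le_max_left _ _))
  linarith

end UpperBound

section Estimate

variable {K : ℕ}

/-- The scalar that turns the vector of fading coefficients of row `i` into its direction, with
real nonnegative direct channel. -/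
noncomputable def rowScale (G : Fin K → Fin K → ℂ) (i : Fin K) : ℂ :=
  unphase (G i i) / (l2norm (mask i (G i)) : ℂ)

/-- The entries of `G` are bounded by `R` and bounded away from zero by `r`. -/
def IsModerate (r R : ℝ) (G : Fin K → Fin K → ℂ) : Prop :=
  ∀ i k, r ≤ ‖G i k‖ ∧ ‖G i k‖ ≤ R

/-- `F` is an estimate of the direction of row `i`, with weighted error at most `e`. -/
def IsRowEstimate (r e ω : ℝ) (G : Fin K → Fin K → ℂ) (i : Fin K) (F : Fin K → ℂ) : Prop :=
  (∀ k, ‖F k‖ ≤ 1) ∧ r ≤ ‖F i‖ ∧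
    ∀ k, idxDist i k ≤ 1 → ‖rowScale G i * G i k - F k‖ * ω ≤ e

theorem IsRowEstimate.mono {r e e' ω : ℝ} {G : Fin K → Fin K → ℂ} {i : Fin K} {F : Fin K → ℂ}
    (h : IsRowEstimate r e ω G i F) (he : e ≤ e') : IsRowEstimate r e' ω G i F :=
  ⟨h.1, h.2.1, fun k hk => (h.2.2 k hk).trans he⟩

theorem norm_rowScale {r R : ℝ} (hr : 0 < r) {G : Fin K → Fin K → ℂ} (hG : IsModerate r R G)
    (i : Fin K) : r ≤ l2norm (mask i (G i)) ∧ l2norm (mask i (G i)) ≤ K * R ∧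
      ‖rowScale G i‖ = (l2norm (mask i (G i)))⁻¹ := by
  have h1 : r ≤ l2norm (mask i (G i)) := (hG i i).1.trans (norm_le_l2norm_mask i (G i))
  refine ⟨h1, l2norm_le_of_norm_le fun k => (norm_mask_le i _ k).trans (hG i k).2, ?_⟩
  rw [rowScale, norm_div, norm_unphase, Complex.norm_real,
    Real.norm_of_nonneg (hr.le.trans h1), one_div]

theorem norm_rowScale_mul_le_one {r R : ℝ} (hr : 0 < r) {G : Fin K → Fin K → ℂ}
    (hG : IsModerate r R G) {i k : Fin K} (hk : idxDist i k ≤ 1) : ‖rowScale G i * G i k‖ ≤ 1 := by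
  obtain ⟨h1, -, h3⟩ := norm_rowScale hr hG i
  have hpos := hr.trans_le h1
  rw [norm_mul, h3, ← div_eq_inv_mul, div_le_one hpos]
  have := norm_le_l2norm (mask i (G i)) k
  simpa [mask, hk] using this

theorem isRowEstimate_of_aligned {b : Fin K → Fin K → ℕ} {c : Codebooks b} {i j : Fin K}
    {r R s ω : ℝ} (hr : 0 < r) (hR : 1 ≤ R) (hs : 0 ≤ s) (hω : 0 ≤ ω)
    {G : Fin K → Fin K → ℂ} (hG : IsModerate r R G) (hsr : K * R * s ≤ r / 2)
    (hc : ∀ n, l2norm (c i j n) = 1) (n : Fin (2 ^ b i j))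
    (hn : l2norm (mask i (G i)) ^ 2 - ‖∑ k, star (c i j n k) * mask i (G i) k‖ ^ 2
      ≤ K * (R * s) ^ 2) :
    IsRowEstimate (r / (2 * (K * R))) ((2 + 4 * (K * R) / r) / r * (K * R * s) * ω) ω G i
      (fadingEstimate G c j i) := by
  have hK : (1 : ℝ) ≤ K := by exact_mod_cast Fin.pos i
  obtain ⟨m, hm, hmax⟩ := exists_rvqSelect_eq (c i j) (mask i (G i))
  have hF : fadingEstimate G c j i = fixPhase i (c i j m) := by rw [fadingEstimate, hm]
  have hτ : l2norm (mask i (G i)) ^ 2 - ‖∑ k, star (c i j m k) * mask i (G i) k‖ ^ 2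
      ≤ (K * R * s) ^ 2 := by
    have h1 := pow_le_pow_left₀ (norm_nonneg _) (hmax n) 2
    have h2 : K * (R * s) ^ 2 ≤ (K * R * s) ^ 2 := by
      have : (K : ℝ) ≤ K ^ 2 := by nlinarith
      calc K * (R * s) ^ 2 ≤ K ^ 2 * (R * s) ^ 2 := by gcongr
        _ = _ := by ring
    linarith
  obtain ⟨hwi, herr⟩ := norm_direction_sub_fixPhase_le (hc m) hr (by positivity) hsr
    (by rw [mask_apply_self]; exact (hG i i).1) (norm_rowScale hr hG i).2.1 hτ
  rw [hF]
  refine ⟨fun k => ?_, ?_, fun k hk => ?_⟩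
  · rw [norm_fixPhase, ← hc m]; exact norm_le_l2norm _ k
  · rwa [norm_fixPhase]
  · have := herr k
    rw [mask_apply_self] at this
    have hmk : mask i (G i) k = G i k := by simp [mask, hk]
    rw [hmk] at this
    exact mul_le_mul_of_nonneg_right this hω

theorem isRowEstimate_of_le_norm {b : Fin K → Fin K → ℕ} {c : Codebooks b} {i j : Fin K}
    {r R r' ω : ℝ} (hr : 0 < r) (hω : 0 ≤ ω) {G : Fin K → Fin K → ℂ} (hG : IsModerate r R G)
    (hc : ∀ n, l2norm (c i j n) = 1) (hn : ∀ n, r' ≤ ‖c i j n i‖) :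
    IsRowEstimate r' (2 * ω) ω G i (fadingEstimate G c j i) := by
  obtain ⟨m, hm, -⟩ := exists_rvqSelect_eq (c i j) (mask i (G i))
  have hF : fadingEstimate G c j i = fixPhase i (c i j m) := by rw [fadingEstimate, hm]
  have hF1 : ∀ k, ‖fixPhase i (c i j m) k‖ ≤ 1 := fun k => by
    rw [norm_fixPhase, ← hc m]; exact norm_le_l2norm _ k
  rw [hF]
  refine ⟨hF1, by rw [norm_fixPhase]; exact hn m, fun k hk => ?_⟩
  refine mul_le_mul_of_nonneg_right ((norm_sub_le _ _).trans ?_) hω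
  linarith [hF1 k, norm_rowScale_mul_le_one hr hG hk]

theorem measurableSet_isRowEstimate (r e ω : ℝ) (b : Fin K → Fin K → ℕ) (i j : Fin K) :
    MeasurableSet {x : (Fin K → Fin K → ℂ) × Codebooks b |
      IsRowEstimate r e ω x.1 i (fadingEstimate x.1 x.2 j i)} := by
  have hF : ∀ k, Measurable fun x : (Fin K → Fin K → ℂ) × Codebooks b =>
      fadingEstimate x.1 x.2 j i k :=
    fun k => (measurable_pi_apply k).comp (measurable_fadingEstimate b j i)
  have hG : ∀ k, Measurable fun x : (Fin K → Fin K → ℂ) × Codebooks b => x.1 i k :=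
    fun k => by fun_prop
  have hu : Measurable fun x : (Fin K → Fin K → ℂ) × Codebooks b => rowScale x.1 i := by
    unfold rowScale
    refine (measurable_unphase.comp (hG i)).div (Complex.measurable_ofReal.comp
      (measurable_l2norm.comp ((measurable_mask i).comp ?_)))
    fun_prop
  have hset : {x : (Fin K → Fin K → ℂ) × Codebooks b |
        IsRowEstimate r e ω x.1 i (fadingEstimate x.1 x.2 j i)}
      = (⋂ k, {x | ‖fadingEstimate x.1 x.2 j i k‖ ≤ 1}) ∩
        ({x | r ≤ ‖fadingEstimate x.1 x.2 j i i‖} ∩ ⋂ k, ⋂ _ : idxDist i k ≤ 1,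
          {x | ‖rowScale x.1 i * x.1 i k - fadingEstimate x.1 x.2 j i k‖ * ω ≤ e}) := by
    ext x; simp [IsRowEstimate]
  rw [hset]
  refine (MeasurableSet.iInter fun k => measurableSet_le (hF k).norm measurable_const).inter
    ((measurableSet_le measurable_const (hF i).norm).inter (MeasurableSet.iInter fun k =>
      MeasurableSet.iInter fun _ => measurableSet_le ?_ measurable_const))
  exact ((hu.mul (hG k)).sub (hF k)).norm.mul_const ω

theorem measurableSet_isModerate (r R : ℝ) :
    MeasurableSet {G : Fin K → Fin K → ℂ | IsModerate r R G} := by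
  have hset : {G : Fin K → Fin K → ℂ | IsModerate r R G}
      = ⋂ i, ⋂ k, {G | r ≤ ‖G i k‖} ∩ {G | ‖G i k‖ ≤ R} := by
    ext G; simp [IsModerate]
  rw [hset]
  refine MeasurableSet.iInter fun i => MeasurableSet.iInter fun k => ?_
  exact (measurableSet_le (by fun_prop) (by fun_prop)).inter
    (measurableSet_le (by fun_prop) (by fun_prop))

end Estimate

section Allocation

variable {K : ℕ}

theorem mul_rpow_neg_pow {P : ℝ} (hP : 0 < P) (ε : ℝ) (m : ℕ) :
    P * (P ^ (-ε)) ^ (2 * m) = P ^ (1 - 2 * ε * m) := by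
  rw [← Real.rpow_natCast, ← Real.rpow_mul hP.le]
  nth_rw 1 [← Real.rpow_one P]
  rw [← Real.rpow_add hP]
  congr 1; push_cast; ring

theorem sqrt_mul_rpow_neg_pow {P : ℝ} (hP : 0 < P) (ε : ℝ) (m : ℕ) :
    √P * (P ^ (-ε)) ^ m = P ^ (1 / 2 - ε * m) := by
  rw [← Real.rpow_natCast, ← Real.rpow_mul hP.le, Real.sqrt_eq_rpow, ← Real.rpow_add hP]
  congr 1; ring

theorem le_two_pow_bits {μ P : ℝ} (hμ : 0 < μ) (hP : 0 < P) {i j : Fin K} {n : ℕ}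
    (hn : |(n : ℝ) - decayingBits μ P i j| < 1) :
    (P * μ ^ (2 * idxDist i j)) ^ 2 / 2 ≤ 2 ^ n := by
  have hX : 0 < P * μ ^ (2 * idxDist i j) := by positivity
  have h1 : 2 * Real.logb 2 (P * μ ^ (2 * idxDist i j)) - 1 ≤ n := by
    have h2 : 2 * Real.logb 2 (P * μ ^ (2 * idxDist i j)) ≤ decayingBits μ P i j := le_max_left _ _
    linarith [(abs_lt.1 hn).1]
  calc (P * μ ^ (2 * idxDist i j)) ^ 2 / 2
      = (2 : ℝ) ^ (2 * Real.logb 2 (P * μ ^ (2 * idxDist i j)) - 1) := by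
        rw [Real.rpow_sub two_pos, Real.rpow_one, mul_comm (2 : ℝ) (Real.logb _ _), Real.rpow_mul two_pos.le,
          Real.rpow_logb two_pos (by norm_num) hX, Real.rpow_two]
    _ ≤ (2 : ℝ) ^ (n : ℝ) := Real.rpow_le_rpow_of_exponent_le one_le_two h1
    _ = 2 ^ n := Real.rpow_natCast _ _

theorem bits_eq_zero {μ P : ℝ} {i j : Fin K} {n : ℕ}
    (hX0 : 0 ≤ P * μ ^ (2 * idxDist i j)) (hX : P * μ ^ (2 * idxDist i j) ≤ 1)
    (hn : |(n : ℝ) - decayingBits μ P i j| < 1) : n = 0 := by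
  have h : decayingBits μ P i j = 0 := by
    refine max_eq_right ?_
    have := Real.logb_nonpos one_lt_two hX0 hX
    linarith
  rw [h, sub_zero, Nat.abs_cast] at hn
  exact_mod_cast Nat.lt_one_iff.1 (by exact_mod_cast hn)

theorem exists_ofReal_exp_neg_le {η : ENNReal} (hη : 0 < η) {c : ℝ} (hc : 0 < c) :
    ∃ A > 0, ENNReal.ofReal (Real.exp (-(c * A ^ 4 / 2))) ≤ η := by
  have h : Tendsto (fun A : ℝ => ENNReal.ofReal (Real.exp (-(c * A ^ 4 / 2)))) atTop (𝓝 0) := by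
    rw [← ENNReal.ofReal_zero]
    refine ENNReal.tendsto_ofReal (Real.tendsto_exp_neg_atTop_nhds_zero.comp ?_)
    exact ((tendsto_pow_atTop (by norm_num)).const_mul_atTop hc).atTop_div_const two_pos
  obtain ⟨A, hA, hA'⟩ := ((h.eventually (ge_mem_nhds hη)).and (eventually_gt_atTop 0)).exists
  exact ⟨A, hA', hA⟩

/-- With the decaying allocation, the error of the estimate of row `i` at TX `j` is of order
`μ ^ (-|i - j|) / √P` with high probability. -/
theorem exists_codebookLaw_not_isRowEstimate_le {ε : ℝ} {b : ℝ → Fin K → Fin K → ℕ}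
    (hb : ∀ P, 1 < P → ∀ i j, |(b P i j : ℝ) - decayingBits (P ^ (-ε)) P i j| < 1)
    {r R : ℝ} (hr : 0 < r) (hR : 1 ≤ R) {η : ENNReal} (hη : 0 < η)
    (htail : K * stdComplexGaussian {z | ‖z‖ < r ∨ R < ‖z‖} ≤ η) (i j : Fin K) :
    ∃ M ≥ 0, ∀ᶠ P : ℝ in atTop, ∀ G : Fin K → Fin K → ℂ, IsModerate r R G →
      codebookLaw (b P) {c | ¬IsRowEstimate (r / (2 * (K * R))) (M / √P)
        ((P ^ (-ε)) ^ idxDist i j) G i (fadingEstimate G c j i)} ≤ η := by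
  have hK : (1 : ℝ) ≤ K := by exact_mod_cast Fin.pos i
  have hR0 : 0 < R := by linarith
  by_cases hcase : 0 < 1 / 2 - ε * idxDist i j
  · obtain ⟨c₀, hc₀, hlaw⟩ := exists_le_codewordLaw i hr hR0.le
    obtain ⟨A, hA, hAη⟩ := exists_ofReal_exp_neg_le hη hc₀
    refine ⟨(2 + 4 * (K * R) / r) / r * (K * R * A), by positivity, ?_⟩
    have hlim : Tendsto (fun P : ℝ => A / P ^ (1 / 2 - ε * idxDist i j)) atTop (𝓝 0) :=
      (tendsto_rpow_atTop hcase).const_div_atTop A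
    filter_upwards [eventually_gt_atTop 1, hlim.eventually (ge_mem_nhds one_pos),
      hlim.eventually (ge_mem_nhds (show 0 < r / (2 * (K * R)) by positivity))]
      with P hP hs1 hsr G hG
    have hP0 : 0 < P := by linarith
    have hsP : 0 < √P := Real.sqrt_pos.2 hP0
    set μ := P ^ (-ε) with hμ
    have hμ0 : 0 < μ := Real.rpow_pos_of_pos hP0 _
    set s := A / P ^ (1 / 2 - ε * idxDist i j) with hs
    have hseq : s = A / (√P * μ ^ idxDist i j) := by rw [hs, hμ, sqrt_mul_rpow_neg_pow hP0]
    have hs0 : 0 < s := by positivity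
    set g := mask i (G i) with hg
    set S : Set (Fin K → ℂ) :=
      {w | l2norm g ^ 2 - ‖∑ k, star (w k) * g k‖ ^ 2 ≤ K * (R * s) ^ 2} with hS
    have hSm : MeasurableSet S := (isClosed_le (by fun_prop) (by fun_prop)).measurableSet
    have hp := hlaw g (by rw [hg, mask_apply_self]; exact (hG i i).1)
      (fun k => (norm_mask_le i _ k).trans (hG i k).2)
      (fun k hk => by simp [hg, mask, not_le.2 hk]) s hs0 hs1
    have hbad := codebookLaw_forall_notMem_le (b P) i j hSm (by positivity) hp
    have hN : c₀ * A ^ 4 / 2 ≤ c₀ * s ^ 4 * 2 ^ b P i j := by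
      have h1 := le_two_pow_bits hμ0 hP0 (hb P hP i j)
      calc c₀ * A ^ 4 / 2
          = c₀ * s ^ 4 * ((P * μ ^ (2 * idxDist i j)) ^ 2 / 2) := by
            have h2 : P * μ ^ (2 * idxDist i j) = (√P * μ ^ idxDist i j) ^ 2 := by
              rw [mul_pow, Real.sq_sqrt hP0.le, ← pow_mul, mul_comm 2]
            rw [h2, hseq]
            field_simp
        _ ≤ _ := by gcongr
    refine le_trans (measure_mono_ae ?_) (hbad.trans (le_trans
      (ENNReal.ofReal_le_ofReal (Real.exp_le_exp.2 (neg_le_neg hN))) hAη))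
    filter_upwards [ae_codebook_l2norm (b P) i j] with c hc hnot n hn
    refine hnot ?_
    have hest := isRowEstimate_of_aligned (ω := μ ^ idxDist i j) hr hR hs0.le (by positivity) hG
      (by rw [le_div_iff₀ (by positivity)] at hsr; linarith) hc n hn
    refine hest.mono (le_of_eq ?_)
    rw [hseq]
    field_simp
  · refine ⟨2, two_pos.le, ?_⟩
    filter_upwards [eventually_gt_atTop 1] with P hP G hG
    have hP0 : 0 < P := by linarith
    have hsP : 0 < √P := Real.sqrt_pos.2 hP0
    set μ := P ^ (-ε) with hμ
    have hμ0 : 0 < μ := Real.rpow_pos_of_pos hP0 _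
    have hle : √P * μ ^ idxDist i j ≤ 1 := by
      rw [hμ, sqrt_mul_rpow_neg_pow hP0]
      exact Real.rpow_le_one_of_one_le_of_nonpos hP.le (not_lt.1 hcase)
    have hb0 : b P i j = 0 := by
      refine bits_eq_zero (by positivity) ?_ (hb P hP i j)
      rw [mul_rpow_neg_pow hP0]
      exact Real.rpow_le_one_of_one_le_of_nonpos hP.le (by linarith)
    have hunion : codebookLaw (b P) {c | ∃ n, ‖c i j n i‖ < r / (K * R)} ≤ η := by
      have hset : {c : Codebooks (b P) | ∃ n, ‖c i j n i‖ < r / (K * R)}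
          = ⋃ n, (fun c : Codebooks (b P) => c i j n) ⁻¹' {w | ‖w i‖ < r / (K * R)} := by
        ext c; simp
      have hm : MeasurableSet {w : Fin K → ℂ | ‖w i‖ < r / (K * R)} :=
        (isOpen_lt (by fun_prop) (by fun_prop)).measurableSet
      rw [hset]
      refine (measure_iUnion_le _).trans ?_
      rw [tsum_fintype]
      simp only [(measurePreserving_codeword (b P) i j _).measure_preimage hm.nullMeasurableSet]
      rw [Finset.sum_const, Finset.card_univ, Fintype.card_fin, hb0, pow_zero, one_smul]
      exact (codewordLaw_norm_lt_le i hr).trans htail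
    refine le_trans (measure_mono_ae ?_) hunion
    filter_upwards [ae_codebook_l2norm (b P) i j] with c hc hnot
    change ∃ n, ‖c i j n i‖ < r / (K * R)
    by_contra hcon
    push Not at hcon
    refine hnot ?_
    have hest := isRowEstimate_of_le_norm (r' := r / (2 * (K * R))) (ω := μ ^ idxDist i j) hr
      (by positivity) hG hc (fun n => le_trans ?_ (hcon n))
    · refine hest.mono ?_
      rw [le_div_iff₀ hsP]
      linarith
    · have : 0 < K * R := by positivity
      exact div_le_div_of_nonneg_left hr.le this (by linarith)

end Allocation

section LowerBound

variable {K : ℕ}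

theorem fadingLaw_not_isModerate_le (r R : ℝ) :
    fadingLaw K {G | ¬IsModerate r R G}
      ≤ K * (K * stdComplexGaussian {z | ‖z‖ < r ∨ R < ‖z‖}) := by
  have hsub : {G : Fin K → Fin K → ℂ | ¬IsModerate r R G}
      ⊆ ⋃ i, ⋃ k, (fun G : Fin K → Fin K → ℂ => G i k) ⁻¹' {z | ‖z‖ < r ∨ R < ‖z‖} := by
    intro G hG
    have hG' : ¬∀ i k, r ≤ ‖G i k‖ ∧ ‖G i k‖ ≤ R := hG
    push Not at hG'
    obtain ⟨i, k, h⟩ := hG'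
    simp only [Set.mem_iUnion]
    refine ⟨i, k, ?_⟩
    change ‖G i k‖ < r ∨ R < ‖G i k‖
    by_cases hlt : ‖G i k‖ < r
    · exact Or.inl hlt
    · exact Or.inr (h (not_lt.1 hlt))
  refine (measure_mono hsub).trans ((measure_iUnion_le _).trans ?_)
  rw [tsum_fintype]
  calc _ ≤ ∑ _i : Fin K, ∑ _k : Fin K, stdComplexGaussian {z | ‖z‖ < r ∨ R < ‖z‖} := by
        refine Finset.sum_le_sum fun i _ => (measure_iUnion_le _).trans ?_
        rw [tsum_fintype]
        refine Finset.sum_le_sum fun k _ => le_of_eq ?_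
        exact (measurePreserving_fading i k).measure_preimage
          (measurableSet_norm_lt_or_lt r R).nullMeasurableSet
    _ = _ := by simp

theorem prod_moderate_not_isRowEstimate_le (r R r' e ω : ℝ) (b : Fin K → Fin K → ℕ) (i j : Fin K)
    {η : ENNReal} (h : ∀ G : Fin K → Fin K → ℂ, IsModerate r R G →
      codebookLaw b {c | ¬IsRowEstimate r' e ω G i (fadingEstimate G c j i)} ≤ η) :
    ((fadingLaw K).prod (codebookLaw b)) {x | IsModerate r R x.1 ∧
      ¬IsRowEstimate r' e ω x.1 i (fadingEstimate x.1 x.2 j i)} ≤ η := by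
  have hm : MeasurableSet {x : (Fin K → Fin K → ℂ) × Codebooks b | IsModerate r R x.1 ∧
      ¬IsRowEstimate r' e ω x.1 i (fadingEstimate x.1 x.2 j i)} :=
    (measurable_fst (measurableSet_isModerate r R)).inter
      (measurableSet_isRowEstimate r' e ω b i j).compl
  rw [Measure.prod_apply hm]
  calc _ ≤ ∫⁻ _G, η ∂fadingLaw K := by
        refine lintegral_mono fun G => ?_
        by_cases hG : IsModerate r R G
        · exact (measure_mono fun c hc => hc.2).trans (h G hG)
        · have : Prod.mk G ⁻¹' {x : (Fin K → Fin K → ℂ) × Codebooks b | IsModerate r R x.1 ∧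
              ¬IsRowEstimate r' e ω x.1 i (fadingEstimate x.1 x.2 j i)} = ∅ := by
            ext c; simp [hG]
          rw [this, measure_empty]; exact zero_le
    _ = η := by simp

theorem exists_le_sinr_dcsiPrecoder {r R M : ℝ} (hr : 0 < r) (hr1 : r ≤ 1) (hR : 1 ≤ R)
    (hM : 0 ≤ M) {ε : ℝ} (hε : 0 < ε) (i : Fin K) :
    ∃ c > 0, ∀ᶠ P : ℝ in atTop, ∀ (b : Fin K → Fin K → ℕ) (G : Fin K → Fin K → ℂ)
      (w : Codebooks b), IsModerate r R G →
      (∀ l j, IsRowEstimate (r / (2 * (K * R))) (M / √P) ((P ^ (-ε)) ^ idxDist l j) G l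
        (fadingEstimate G w j l)) →
      c * P ≤ sinr (wynerMatrix (P ^ (-ε)) G) (dcsiPrecoder (P ^ (-ε)) P G w) i := by
  have hK : (1 : ℝ) ≤ K := by exact_mod_cast Fin.pos i
  have hKR : 0 < K * R := by positivity
  have hRr : R ≤ R / r := le_div_self (by linarith) hr hr1
  obtain ⟨c, hc, μ₀, hμ₀, P₀, h⟩ := exists_le_sinr (K := K) (r := r / (2 * (K * R))) (R := R / r)
    (U := r⁻¹) (M := M) (by positivity) (by positivity) (by positivity) hM
  refine ⟨c, hc, ?_⟩
  filter_upwards [eventually_gt_atTop 1, eventually_ge_atTop P₀,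
    (tendsto_rpow_neg_atTop hε).eventually (ge_mem_nhds hμ₀)] with P hP hP₀ hμ b G w hG hest
  have hP0 : 0 < P := by linarith
  have hscale := fun l => norm_rowScale hr hG l
  refine h (P ^ (-ε)) P (Real.rpow_pos_of_pos hP0 _)
    (Real.rpow_le_one_of_one_le_of_nonpos hP.le (by linarith)) hμ hP0 hP₀ G (rowScale G)
    (fun j => fadingEstimate G w j) (fun i k => (hG i k).2.trans hRr) (fun l => ?_) (fun l => ?_)
    (fun l k => ?_) (fun l => ?_) (fun j l k => ?_) (fun j l => (hest l j).2.1)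
    (fun j l m hlm => (hest l j).2.2 m hlm) i
  · rw [← norm_pos_iff, (hscale l).2.2]
    exact inv_pos.2 (hr.trans_le (hscale l).1)
  · rw [(hscale l).2.2]
    exact inv_anti₀ hr (hscale l).1
  · rw [norm_mul, (hscale l).2.2, ← div_eq_inv_mul]
    exact div_le_div₀ (by linarith) (hG l k).2 hr (hscale l).1
  · rw [norm_mul, (hscale l).2.2, ← div_eq_inv_mul]
    have h1 : l2norm (mask l (G l)) ≤ 2 * (K * R) := by linarith [(hscale l).2.1]
    exact div_le_div₀ (norm_nonneg _) (hG l l).1 (hr.trans_le (hscale l).1) h1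
  · exact ((hest l j).1 k).trans (hR.trans hRr)

/-- With the decaying allocation, the signal to interference and noise ratio is of order `P` with
high probability. -/
theorem exists_prob_sinr_lt_le {ε : ℝ} (hε : 0 < ε) {b : ℝ → Fin K → Fin K → ℕ}
    (hb : ∀ P, 1 < P → ∀ i j, |(b P i j : ℝ) - decayingBits (P ^ (-ε)) P i j| < 1)
    (i : Fin K) {η : ENNReal} (hη : 0 < η) :
    ∃ c > 0, ∀ᶠ P : ℝ in atTop, ((fadingLaw K).prod (codebookLaw (b P)))
      {x | ¬c * P ≤ sinr (wynerMatrix (P ^ (-ε)) x.1) (dcsiPrecoder (P ^ (-ε)) P x.1 x.2) i}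
        ≤ K * η + K * (K * η) := by
  have hK0 : (K : ENNReal) ≠ 0 := by exact_mod_cast (Fin.pos i).ne'
  obtain ⟨r, hr, R, hR, hr1, htail⟩ := exists_stdComplexGaussian_tail_le
    (η := η / K) (ENNReal.div_pos hη.ne' (ENNReal.natCast_ne_top K))
  have htail' : K * stdComplexGaussian {z | ‖z‖ < r ∨ R < ‖z‖} ≤ η := by
    calc _ ≤ K * (η / K) := by gcongr
      _ = η := ENNReal.mul_div_cancel hK0 (ENNReal.natCast_ne_top K)
  choose M hM0 hM using fun l j =>
    exists_codebookLaw_not_isRowEstimate_le hb hr hR hη htail' l j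
  have hMsum : ∀ l j, M l j ≤ ∑ l, ∑ j, M l j := fun l j =>
    (Finset.single_le_sum (fun j _ => hM0 l j) (Finset.mem_univ j)).trans
      (Finset.single_le_sum (f := fun l => ∑ j, M l j)
        (fun l _ => Finset.sum_nonneg fun j _ => hM0 l j) (Finset.mem_univ l))
  obtain ⟨c, hc, hsinr⟩ := exists_le_sinr_dcsiPrecoder hr hr1 hR
    (Finset.sum_nonneg fun l _ => Finset.sum_nonneg fun j _ => hM0 l j) hε i
  refine ⟨c, hc, ?_⟩
  filter_upwards [hsinr, eventually_all.2 fun l => eventually_all.2 fun j => hM l j]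
    with P hP hMP
  set bad : Fin K → Fin K → Set ((Fin K → Fin K → ℂ) × Codebooks (b P)) := fun l j =>
    {x | IsModerate r R x.1 ∧ ¬IsRowEstimate (r / (2 * (K * R))) (M l j / √P)
      ((P ^ (-ε)) ^ idxDist l j) x.1 l (fadingEstimate x.1 x.2 j l)} with hbad
  have hsub : {x : (Fin K → Fin K → ℂ) × Codebooks (b P) | ¬c * P ≤
        sinr (wynerMatrix (P ^ (-ε)) x.1) (dcsiPrecoder (P ^ (-ε)) P x.1 x.2) i}
      ⊆ (Prod.fst ⁻¹' {G | ¬IsModerate r R G}) ∪ ⋃ l, ⋃ j, bad l j := by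
    intro x hx
    by_contra hcon
    rw [Set.mem_union, not_or] at hcon
    have hG : IsModerate r R x.1 := not_not.1 hcon.1
    refine hx (hP (b P) x.1 x.2 hG fun l j => ?_)
    by_contra hnot
    refine hcon.2 (Set.mem_iUnion.2 ⟨l, Set.mem_iUnion.2 ⟨j, hG, fun hest => hnot ?_⟩⟩)
    exact hest.mono (div_le_div_of_nonneg_right (hMsum l j) (Real.sqrt_nonneg P))
  refine (measure_mono hsub).trans ((measure_union_le _ _).trans (add_le_add ?_ ?_))
  · have hm : MeasurableSet {G : Fin K → Fin K → ℂ | ¬IsModerate r R G} :=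
      (measurableSet_isModerate r R).compl
    rw [measurePreserving_fst.measure_preimage hm.nullMeasurableSet]
    exact (fadingLaw_not_isModerate_le r R).trans (by gcongr)
  · refine (measure_iUnion_le _).trans ?_
    rw [tsum_fintype]
    calc _ ≤ ∑ _l : Fin K, ∑ _j : Fin K, η := by
          refine Finset.sum_le_sum fun l _ => (measure_iUnion_le _).trans ?_
          rw [tsum_fintype]
          exact Finset.sum_le_sum fun j _ =>
            prod_moderate_not_isRowEstimate_le _ _ _ _ _ _ l j (hMP l j)
      _ = _ := by simp

theorem le_rate_of_prob_sinr_lt_le {Ω : Type} [MeasurableSpace Ω] {ν : Measure Ω}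
    [IsProbabilityMeasure ν] {μ P C t η : ℝ} (hμ : 0 < μ) (hμ1 : μ ≤ 1) (hP : 1 < P)
    (hC : 0 ≤ C) {T : (Fin K → Fin K → ℂ) → Ω → Matrix (Fin K) (Fin K) ℂ} (i : Fin K)
    (hm : ∀ j i, Measurable fun x : (Fin K → Fin K → ℂ) × Ω => T x.1 x.2 j i)
    (hT : ∀ G ω, l2norm (fun j => T G ω j i) ^ 2 ≤ C * P) (ht : 1 ≤ t) (hη : 0 ≤ η)
    (hprob : ((fadingLaw K).prod ν) {x | ¬t ≤ sinr (wynerMatrix μ x.1) (T x.1 x.2) i}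
      ≤ ENNReal.ofReal η) :
    (1 - η) * Real.logb 2 t ≤ rate μ ν T i := by
  have hint := integrable_logb_one_add_sinr (ν := ν) hμ hμ1 hP hC i hm hT
  have hmarkov := mul_meas_ge_le_integral_of_nonneg
    (Eventually.of_forall fun x => logb_one_add_sinr_nonneg _ _ _) hint (Real.logb 2 t)
  have hS : MeasurableSet {x : (Fin K → Fin K → ℂ) × Ω |
      t ≤ sinr (wynerMatrix μ x.1) (T x.1 x.2) i} :=
    measurableSet_le measurable_const
      (measurable_sinr (measurable_wynerMatrix measurable_fst μ) hm i)
  have hreal : 1 - η ≤ ((fadingLaw K).prod ν).real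
      {x | Real.logb 2 t ≤ Real.logb 2 (1 + sinr (wynerMatrix μ x.1) (T x.1 x.2) i)} := by
    have h1 : ((fadingLaw K).prod ν).real {x | t ≤ sinr (wynerMatrix μ x.1) (T x.1 x.2) i}ᶜ ≤ η :=
      ENNReal.toReal_le_of_le_ofReal hη hprob
    rw [probReal_compl_eq_one_sub hS] at h1
    have h2 : ((fadingLaw K).prod ν).real {x | t ≤ sinr (wynerMatrix μ x.1) (T x.1 x.2) i}
        ≤ ((fadingLaw K).prod ν).real
          {x | Real.logb 2 t ≤ Real.logb 2 (1 + sinr (wynerMatrix μ x.1) (T x.1 x.2) i)} := by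
      refine measureReal_mono fun x hx => ?_
      have hx' : t ≤ sinr (wynerMatrix μ x.1) (T x.1 x.2) i := hx
      exact Real.logb_le_logb_of_le one_lt_two (by linarith) (by linarith)
    linarith
  have hlog : 0 ≤ Real.logb 2 t := Real.logb_nonneg one_lt_two ht
  calc _ ≤ _ := mul_le_mul_of_nonneg_right hreal hlog
    _ = _ := mul_comm _ _
    _ ≤ _ := hmarkov

theorem hasMultiplexingGain_one {ε : ℝ} (hε : 0 < ε) {b : ℝ → Fin K → Fin K → ℕ}
    (hb : ∀ P, 1 < P → ∀ i j, |(b P i j : ℝ) - decayingBits (P ^ (-ε)) P i j| < 1)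
    (i : Fin K) :
    HasMultiplexingGain (Ω := fun P => Codebooks (b P)) ε (fun P => codebookLaw (b P))
      (fun P G c => dcsiPrecoder (P ^ (-ε)) P G c) i 1 := by
  have hK : (0 : ℝ) < K := by exact_mod_cast Fin.pos i
  refine tendsto_order.2 ⟨fun a ha => ?_, fun a ha => ?_⟩
  · obtain ⟨η, hη, hη1, haη⟩ : ∃ η : ℝ, 0 < η ∧ η < 1 ∧ a < 1 - 2 * η :=
      ⟨min ((1 - a) / 3) (1 / 2), by
        have : 0 < 1 - a := by linarith
        positivity, by
        have := min_le_right ((1 - a) / 3) (1 / 2); linarith, by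
        have := min_le_left ((1 - a) / 3) (1 / 2); linarith⟩
    set ζ : ℝ := η / (K + K * K) with hζ
    have hζ0 : 0 < ζ := by positivity
    obtain ⟨c, hc, hprob⟩ := exists_prob_sinr_lt_le hε hb i (ENNReal.ofReal_pos.2 hζ0)
    have htotal : (K : ENNReal) * ENNReal.ofReal ζ + K * (K * ENNReal.ofReal ζ)
        = ENNReal.ofReal η := by
      rw [← ENNReal.ofReal_natCast K, ← ENNReal.ofReal_mul hK.le, ← ENNReal.ofReal_mul hK.le,
        ← ENNReal.ofReal_add (by positivity) (by positivity), hζ]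
      congr 1
      field_simp
    filter_upwards [hprob, eventually_gt_atTop 1, eventually_ge_atTop (1 / c),
      tendsto_logb_two_atTop.eventually_ge_atTop (|Real.logb 2 c| / η)] with P hPprob hP hPc hPlog
    have hP0 : 0 < P := by linarith
    have hlogP : 0 < Real.logb 2 P := Real.logb_pos one_lt_two hP
    rw [htotal] at hPprob
    rw [div_le_iff₀ hc] at hPc
    have hrate := le_rate_of_prob_sinr_lt_le (Real.rpow_pos_of_pos hP0 (-ε))
      (Real.rpow_le_one_of_one_le_of_nonpos hP.le (by linarith)) hP hK.le i
      (measurable_dcsiPrecoder (P ^ (-ε)) P (b P))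
      (fun G w => l2norm_dcsiPrecoder_sq_le (P ^ (-ε)) hP0.le G w i) (by linarith) hη.le hPprob
    rw [Real.logb_mul hc.ne' hP0.ne'] at hrate
    rw [div_le_iff₀ hη] at hPlog
    refine haη.trans_le ?_
    rw [le_div_iff₀ hlogP]
    refine le_trans ?_ hrate
    have h1 : -|Real.logb 2 c| ≤ (1 - η) * Real.logb 2 c := by
      have h2 : |(1 - η) * Real.logb 2 c| ≤ |Real.logb 2 c| := by
        rw [abs_mul, abs_of_pos (by linarith)]
        exact mul_le_of_le_one_left (abs_nonneg _) (by linarith)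
      linarith [neg_abs_le ((1 - η) * Real.logb 2 c)]
    nlinarith
  · have h := isMultiplexingGainBound_one hε i (fun P => Codebooks (b P))
      (fun P => codebookLaw (b P)) (fun P G c => dcsiPrecoder (P ^ (-ε)) P G c)
      (isPrecodingFamily_dcsiPrecoder b ε) ((a - 1) / 2) (by linarith)
    filter_upwards [h] with P hP
    linarith

end LowerBound

end Wyner

theorem mainTheorem1 (K : ℕ) (ε : ℝ) (hε : ε ∈ Set.Ioo (0 : ℝ) 1)
    (b : ℝ → Fin K → Fin K → ℕ)
    -- `b P i j` is the real number of bits of the allocation, rounded up or down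
    (hb : ∀ P, 1 < P → ∀ i j,
      |(b P i j : ℝ) - Wyner.decayingBits (P ^ (-ε)) P i j| < 1) :
    Wyner.IsPrecodingFamily (K := K) (Ω := fun P => Wyner.Codebooks (b P))
      (fun P G c => Wyner.dcsiPrecoder (P ^ (-ε)) P G c) ∧
    ∀ i : Fin K,
      Wyner.HasMultiplexingGain (Ω := fun P => Wyner.Codebooks (b P)) ε
        (fun P => Wyner.codebookLaw (b P))
        (fun P G c => Wyner.dcsiPrecoder (P ^ (-ε)) P G c) i 1 ∧
      Wyner.IsMultiplexingGainBound ε i 1 := by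
  exact ⟨Wyner.isPrecodingFamily_dcsiPrecoder b ε, fun i =>
    ⟨Wyner.hasMultiplexingGain_one hε.1 hb i, Wyner.isMultiplexingGainBound_one hε.1 i⟩⟩
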